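/- Let $N\ge 2$ be an integer, let $\alpha,\lambda,l>0$, and let $k_1,\dots,k_N\in(0,l)$. Indices $i$ range over $\{1,\dots,N\}$ and are cyclic (a nonpositive index $m$ means $m+N$, so index $0$ means $N$). Let $f^{(i)}\in C([0,1]\times[0,\infty))$ and $q^{(i)},d_0^{(i)},d_1^{(i)},r\in C^1([0,\infty))$, and let the initial data $u_0^{(i)},u_0^{\mathrm{ref}},v_0^{(i)},\hat q_0^{(i)}$ be continuous on $[0,1]$. Consider the closed-loop system, for $(x,t)\in(0,1)\times(0,\infty)$, $$u^{(i)}_t=\alpha u^{(i)}_{xx}-\lambda u^{(i)}+f^{(i)},\quad u^{(i)}(0,t)=q^{(i)}(t)+U_0^{(i)}(t),\quad u^{(i)}_x(1,t)=-l\,u^{(i)}(1,t)+U_1^{(i)}(t),$$ $$u^{\mathrm{ref}}_t=\alpha u^{\mathrm{ref}}_{xx}-\lambda u^{\mathrm{ref}},\quad u^{\mathrm{ref}}(0,t)=r(t),\quad u^{\mathrm{ref}}_x(1,t)=-l\,u^{\mathrm{ref}}(1,t),$$ $$v^{(i)}_t=\alpha v^{(i)}_{xx}-\lambda v^{(i)},\quad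 v^{(i)}(0,t)=U_0^{(i)}(t),\quad v^{(i)}_x(1,t)=-l\,v^{(i)}(1,t)+U_1^{(i)}(t),$$ $$\hat q^{(i)}_t=\alpha\hat q^{(i)}_{xx}-\lambda\hat q^{(i)},\quad \hat q^{(i)}_x(0,t)=u^{(i)}_x(0,t)-v^{(i)}_x(0,t),\quad \hat q^{(i)}_x(1,t)=-l\,\hat q^{(i)}(1,t),$$ with initial values $u_0^{(i)},u_0^{\mathrm{ref}},v_0^{(i)},\hat q_0^{(i)}$ and control laws $$U_0^{(i)}(t)=r(t)-\hat q^{(i)}(0,t)+d_0^{(i)}(t),\qquad U_1^{(i)}(t)=k_i\bigl(u^{(i-1)}(1,t)-u^{\mathrm{ref}}(1,t)\bigr)+d_1^{(i)}(t).$$ A solution is one whose components all lie in $C([0,\infty);H^2(0,1))\cap C^1([0,\infty);L^2(0,1))$, the differential equations holding in $L^2(0,1)$ for every $t>0$. For $\sigma\in(0,\lambda)$ put $\mathcal N=l^{-N}\prod_{i=1}^N k_i$, $$\mathcal M_i=1+\sum_{m=1}^{i}\frac{\prod_{r=0}^{m-1}k_{i-r}}{l^m}+\sum_{m=i+1}^{N-1}\frac{\bigl(\prod_{r=0}^{i-1}k_{i-r}\bigr)\bigl(\prod_{s=0}^{m-i-1}k_{N-s}\bigr)}{l^m},\qquad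 \mathcal C_i=\frac{\mathcal M_i}{1-\mathcal N},\qquad \widetilde{\mathcal C}_i=1+\frac{k_i}{l}\mathcal C_{i-1},$$ $$\mathcal D(t)=\frac{2}{\lambda-\sigma}\max_i\|f^{(i)}\|_{C([0,1]\times[0,t])}+\max_i\|d_0^{(i)}\|_{C([0,t])}+\frac1l\max_i\|d_1^{(i)}\|_{C([0,t])}.$$ Then the closed-loop system is input-to-state stable in the max-norm with respect to the inputs $f^{(i)},d_0^{(i)},d_1^{(i)},r,q^{(i)}$: there are $\beta\in\mathcal{KL}$ and $\gamma\in\mathcal K$, depending only on $N,\alpha,\lambda,l,k_1,\dots,k_N$, such that for every choice of data and every solution and all $t\ge 0$, the max-norm of the state at time $t$ is at most $\beta(\text{max-norm of the initial state},t)+\gamma(\text{max-norm of the inputs on }[0,t])$. Here the max-norm of the state is $\max_i\|u^{(i)}\|_{C([0,1])}+\|u^{\mathrm{ref}}\|_{C([0,1])}+\max_i\|v^{(i)}\|_{C([0,1])}+\max_i\|\hat q^{(i)}\|_{C([0,1])}$, and that of the inputs is $\max_i\|f^{(i)}\|_{C([0,1]\times[0,t])}+\max_i\|d_0^{(i)}\|_{C([0,t])}+\max_i\|d_1^{(i)}\|_{C([0,t])}+\|r\|_{C([0,t])}+\max_i\|q^{(i)}\|_{C([0,t])}$.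 Moreover, for every $\sigma\in(0,\lambda)$, every such solution satisfies, for every $i$ and all $t>0$, $$\begin{aligned}&\|u^{(i)}(\cdot,t)\|_{C([0,1])}+\|u^{\mathrm{ref}}(\cdot,t)\|_{C([0,1])}+\|v^{(i)}(\cdot,t)\|_{C([0,1])}+\|\hat q^{(i)}(\cdot,t)\|_{C([0,1])}\\ \le{}&(1+2\widetilde{\mathcal C}_i)e^{-\sigma t}\Bigl(2\max_j\|u_0^{(j)}\|_{C([0,1])}+\|u_0^{\mathrm{ref}}\|_{C([0,1])}\Bigr)\\&+(4+2\widetilde{\mathcal C}_i)e^{-\sigma t}\Bigl(\max_j\|v_0^{(j)}\|_{C([0,1])}+\max_j\|\hat q_0^{(j)}\|_{C([0,1])}\Bigr)\\ &+3\|r\|_{C([0,t])}+2\|q^{(i)}\|_{C([0,t])}+(1+2\widetilde{\mathcal C}_i)\mathcal D(t).\end{aligned}$$ -/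

import Mathlib

open Set MeasureTheory Filter Topology

namespace MAS

noncomputable section

/-- Lebesgue measure on the interval `(0,1)`. -/
abbrev unitMeasure : Measure ℝ := volume.restrict (Ioo (0 : ℝ) 1)

/-- The space `L²(0,1)`. -/
abbrev L2 : Type := Lp ℝ 2 unitMeasure

/-- `g` is the weak derivative of `v` on `(0,1)`. -/
def HasWeakDeriv (v g : ℝ → ℝ) : Prop :=
  ∀ φ : ℝ → ℝ, ContDiff ℝ (⊤ : ℕ∞) φ → HasCompactSupport φ → tsupport φ ⊆ Ioo (0 : ℝ) 1 →
    ∫ x in Ioo (0 : ℝ) 1, v x * deriv φ x = -∫ x in Ioo (0 : ℝ) 1, g x * φ x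

/-- `u` belongs to `C([0,∞); H²(0,1)) ∩ C¹([0,∞); L²(0,1))`, where `u x t` is the value at the
point `x` and time `t`. The curves `U`, `Ux`, `Uxx` in `L²(0,1)` are `u` and its first and second
weak derivatives in `x`; continuity in the `H²`-norm is continuity of these three curves in
`L²(0,1)`. As usual, `u(·,t)` is the representative that is continuous on `[0,1]`. -/
structure IsH2Curve (u : ℝ → ℝ → ℝ) (U Ux Uxx : ℝ → L2) : Prop where
  continuousOn_slice : ∀ t, 0 ≤ t → ContinuousOn (fun x => u x t) (Icc (0 : ℝ) 1)
  represents : ∀ t, 0 ≤ t → ∀ᵐ x ∂unitMeasure, (U t : ℝ → ℝ) x = u x t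
  weakDeriv_one : ∀ t, 0 ≤ t → HasWeakDeriv (U t) (Ux t)
  weakDeriv_two : ∀ t, 0 ≤ t → HasWeakDeriv (Ux t) (Uxx t)
  continuousOn_zero : ContinuousOn U (Ici 0)
  continuousOn_one : ContinuousOn Ux (Ici 0)
  continuousOn_two : ContinuousOn Uxx (Ici 0)
  contDiffOn_time : ContDiffOn ℝ 1 U (Ici 0)

/-- `u ∈ C([0,∞); H²(0,1)) ∩ C¹([0,∞); L²(0,1))` satisfies `u_t = α u_xx - lam u + f` in
`L²(0,1)` for every `t > 0`. -/
def SolvesPDE (α lam : ℝ) (f u : ℝ → ℝ → ℝ) : Prop :=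
  ∃ U Ux Uxx : ℝ → L2, IsH2Curve u U Ux Uxx ∧
    ∀ t, 0 < t → ∀ᵐ x ∂unitMeasure,
      ((deriv U t : L2) : ℝ → ℝ) x = α * (Uxx t : ℝ → ℝ) x - lam * u x t + f x t

/-- The derivative in `x` of a function on `[0,1]` (one-sided at the end points); functions in
`H²(0,1)` are continuously differentiable on `[0,1]`. -/
def xDeriv (h : ℝ → ℝ) (x : ℝ) : ℝ := derivWithin h (Icc (0 : ℝ) 1) x

/-- The max-norm over `S`. -/
def supNorm {Y : Type*} (S : Set Y) (h : Y → ℝ) : ℝ := sSup ((fun y => |h y|) '' S)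

/-- The maximum of `a i` over the agents `i = 1, …, N`. -/
def agentMax (N : ℕ) (a : ℕ → ℝ) : ℝ := sSup (a '' Icc 1 N)

/-- The predecessor of agent `i` on the directed cycle `1 → 2 → ⋯ → N → 1`. -/
def prev (N i : ℕ) : ℕ := if i = 1 then N else i - 1

/-- The parameters: number of agents, diffusion, reaction and Robin coefficients, control gains.
Agents are numbered `1, …, N`. -/
structure Params where
  N : ℕ
  α : ℝ
  lam : ℝ
  l : ℝ
  k : ℕ → ℝ

structure Params.Admissible (P : Params) : Prop where
  two_le_N : 2 ≤ P.N
  α_pos : 0 < P.α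
  lam_pos : 0 < P.lam
  l_pos : 0 < P.l
  k_mem : ∀ i ∈ Icc 1 P.N, P.k i ∈ Ioo 0 P.l

/-- The external inputs: in-domain disturbances `f i x t`, observable Dirichlet disturbances
`q i t`, reference signal `r t`, implementation disturbances `d0 i t`, `d1 i t`. -/
structure Inputs where
  f : ℕ → ℝ → ℝ → ℝ
  q : ℕ → ℝ → ℝ
  r : ℝ → ℝ
  d0 : ℕ → ℝ → ℝ
  d1 : ℕ → ℝ → ℝ

structure Inputs.Regular (w : Inputs) (N : ℕ) : Prop where
  f_cont : ∀ i ∈ Icc 1 N,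
    ContinuousOn (fun p : ℝ × ℝ => w.f i p.1 p.2) (Icc (0 : ℝ) 1 ×ˢ Ici (0 : ℝ))
  q_contDiff : ∀ i ∈ Icc 1 N, ContDiffOn ℝ 1 (w.q i) (Ici 0)
  r_contDiff : ContDiffOn ℝ 1 w.r (Ici 0)
  d0_contDiff : ∀ i ∈ Icc 1 N, ContDiffOn ℝ 1 (w.d0 i) (Ici 0)
  d1_contDiff : ∀ i ∈ Icc 1 N, ContDiffOn ℝ 1 (w.d1 i) (Ici 0)

/-- A state of the closed loop at one instant: spatial profiles of the agents `u i`, the reference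
`uref`, the auxiliary systems `v i` and the observers `qhat i`. -/
structure Profile where
  u : ℕ → ℝ → ℝ
  uref : ℝ → ℝ
  v : ℕ → ℝ → ℝ
  qhat : ℕ → ℝ → ℝ

structure Profile.IsContinuous (X : Profile) (N : ℕ) : Prop where
  u_cont : ∀ i ∈ Icc 1 N, ContinuousOn (X.u i) (Icc (0 : ℝ) 1)
  uref_cont : ContinuousOn X.uref (Icc (0 : ℝ) 1)
  v_cont : ∀ i ∈ Icc 1 N, ContinuousOn (X.v i) (Icc (0 : ℝ) 1)
  qhat_cont : ∀ i ∈ Icc 1 N, ContinuousOn (X.qhat i) (Icc (0 : ℝ) 1)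

/-- The Dirichlet control law `r(t) - qhat i (0,t) + d0 i (t)`. -/
def control0 (w : Inputs) (X : ℝ → Profile) (i : ℕ) (t : ℝ) : ℝ :=
  w.r t - (X t).qhat i 0 + w.d0 i t

/-- The Robin control law `k i (u (i-1) (1,t) - uref (1,t)) + d1 i (t)`, indices being cyclic. -/
def control1 (P : Params) (w : Inputs) (X : ℝ → Profile) (i : ℕ) (t : ℝ) : ℝ :=
  P.k i * ((X t).u (prev P.N i) 1 - (X t).uref 1) + w.d1 i t

/-- `X` is a solution of the closed-loop system with inputs `w` and initial state `X₀`, in the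
class `C([0,∞); H²(0,1)) ∩ C¹([0,∞); L²(0,1))`. -/
structure IsSolution (P : Params) (w : Inputs) (X₀ : Profile) (X : ℝ → Profile) : Prop where
  u_pde : ∀ i ∈ Icc 1 P.N, SolvesPDE P.α P.lam (w.f i) (fun x t => (X t).u i x)
  u_left : ∀ i ∈ Icc 1 P.N, ∀ t, 0 < t → (X t).u i 0 = w.q i t + control0 w X i t
  u_right : ∀ i ∈ Icc 1 P.N, ∀ t, 0 < t →
    xDeriv ((X t).u i) 1 = -P.l * (X t).u i 1 + control1 P w X i t
  u_init : ∀ i ∈ Icc 1 P.N, ∀ x ∈ Ioo (0 : ℝ) 1, (X 0).u i x = X₀.u i x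
  uref_pde : SolvesPDE P.α P.lam (fun _ _ => 0) (fun x t => (X t).uref x)
  uref_left : ∀ t, 0 < t → (X t).uref 0 = w.r t
  uref_right : ∀ t, 0 < t → xDeriv (X t).uref 1 = -P.l * (X t).uref 1
  uref_init : ∀ x ∈ Ioo (0 : ℝ) 1, (X 0).uref x = X₀.uref x
  v_pde : ∀ i ∈ Icc 1 P.N, SolvesPDE P.α P.lam (fun _ _ => 0) (fun x t => (X t).v i x)
  v_left : ∀ i ∈ Icc 1 P.N, ∀ t, 0 < t → (X t).v i 0 = control0 w X i t
  v_right : ∀ i ∈ Icc 1 P.N, ∀ t, 0 < t →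
    xDeriv ((X t).v i) 1 = -P.l * (X t).v i 1 + control1 P w X i t
  v_init : ∀ i ∈ Icc 1 P.N, ∀ x ∈ Ioo (0 : ℝ) 1, (X 0).v i x = X₀.v i x
  qhat_pde : ∀ i ∈ Icc 1 P.N, SolvesPDE P.α P.lam (fun _ _ => 0) (fun x t => (X t).qhat i x)
  qhat_left : ∀ i ∈ Icc 1 P.N, ∀ t, 0 < t →
    xDeriv ((X t).qhat i) 0 = xDeriv ((X t).u i) 0 - xDeriv ((X t).v i) 0
  qhat_right : ∀ i ∈ Icc 1 P.N, ∀ t, 0 < t →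
    xDeriv ((X t).qhat i) 1 = -P.l * (X t).qhat i 1
  qhat_init : ∀ i ∈ Icc 1 P.N, ∀ x ∈ Ioo (0 : ℝ) 1, (X 0).qhat i x = X₀.qhat i x

/-- The norm of `C([0,1])`. -/
def normC (h : ℝ → ℝ) : ℝ := supNorm (Icc (0 : ℝ) 1) h

/-- The norm of `C([0,t])`. -/
def normT (t : ℝ) (h : ℝ → ℝ) : ℝ := supNorm (Icc (0 : ℝ) t) h

/-- The norm of `C([0,1] × [0,t])`. -/
def normQ (t : ℝ) (h : ℝ → ℝ → ℝ) : ℝ :=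
  supNorm (Icc (0 : ℝ) 1 ×ˢ Icc (0 : ℝ) t) (fun p : ℝ × ℝ => h p.1 p.2)

/-- `(k 1 ⋯ k N) / l ^ N`. -/
def Params.gainRatio (P : Params) : ℝ := (∏ i ∈ Finset.Icc 1 P.N, P.k i) / P.l ^ P.N

def Params.M (P : Params) (i : ℕ) : ℝ :=
  1 + ∑ m ∈ Finset.Icc 1 i, (∏ r ∈ Finset.range m, P.k (i - r)) / P.l ^ m
    + ∑ m ∈ Finset.Icc (i + 1) (P.N - 1),
        ((∏ r ∈ Finset.range i, P.k (i - r)) * ∏ s ∈ Finset.range (m - i), P.k (P.N - s)) /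
          P.l ^ m

def Params.C (P : Params) (i : ℕ) : ℝ := P.M i / (1 - P.gainRatio)

def Params.Ctilde (P : Params) (i : ℕ) : ℝ := 1 + P.k i / P.l * P.C (prev P.N i)

/-- The size on `[0,t]` of the unobservable disturbances. -/
def Params.D (P : Params) (σ : ℝ) (w : Inputs) (t : ℝ) : ℝ :=
  2 / (P.lam - σ) * agentMax P.N (fun i => normQ t (w.f i))
    + agentMax P.N (fun i => normT t (w.d0 i))
    + 1 / P.l * agentMax P.N (fun i => normT t (w.d1 i))

/-- The max-norm of the whole state. -/
def Profile.size (X : Profile) (N : ℕ) : ℝ :=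
  agentMax N (fun i => normC (X.u i)) + normC X.uref
    + agentMax N (fun i => normC (X.v i)) + agentMax N (fun i => normC (X.qhat i))

/-- The max-norm on `[0,t]` of all external inputs. -/
def Inputs.size (w : Inputs) (N : ℕ) (t : ℝ) : ℝ :=
  agentMax N (fun i => normQ t (w.f i)) + agentMax N (fun i => normT t (w.d0 i))
    + agentMax N (fun i => normT t (w.d1 i)) + normT t w.r
    + agentMax N (fun i => normT t (w.q i))

/-- Comparison functions of class `K`. -/
def ClassK (γ : ℝ → ℝ) : Prop :=
  ContinuousOn γ (Ici 0) ∧ StrictMonoOn γ (Ici 0) ∧ γ 0 = 0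

/-- Comparison functions of class `KL`. -/
def ClassKL (β : ℝ → ℝ → ℝ) : Prop :=
  ContinuousOn (fun p : ℝ × ℝ => β p.1 p.2) (Ici (0 : ℝ) ×ˢ Ici (0 : ℝ)) ∧
  (∀ t, 0 ≤ t → ClassK (fun s => β s t)) ∧
  (∀ s, 0 < s → StrictAntiOn (β s) (Ici 0) ∧ Tendsto (β s) atTop (𝓝 0))

/-- Input-to-state stability in the max-norm of the closed-loop system. -/
def InputToStateStable (P : Params) : Prop :=
  ∃ β : ℝ → ℝ → ℝ, ∃ γ : ℝ → ℝ, ClassKL β ∧ ClassK γ ∧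
    ∀ (w : Inputs) (X₀ : Profile) (X : ℝ → Profile),
      w.Regular P.N → X₀.IsContinuous P.N → IsSolution P w X₀ X →
      ∀ t, 0 ≤ t → (X t).size P.N ≤ β (X₀.size P.N) t + γ (w.size P.N t)

end

end MAS

/-! Everything rests on one comparison principle. If `σ < lam`, the spatially constant function
`m(t) = G * exp (-σ t)` with `G ≥ 0` is a supersolution of the heat equation with damping `lam`: it
leaves room for a source up to `(lam - σ) * m` and for Robin data up to `l * m`. Testing the
equation with the positive part of `y - m` shows that its squared `L²` norm does not increase, so `y
≤ m` persists (`SolvesPDE.le_barrier`, `SolvesPDE.abs_le_barrier`). For solutions that are only `H²`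
in space, this needs their structure as iterated primitives (`IsH2Curve.exists_isH2`), integration
by parts against a truncation (`IsH2.integral_posPart_mul_le`) and differentiability of the squared
norm of the positive part on `L²` (`L2.hasFDerivAt_norm_posPart_sq`).

The closed loop decouples through two differences. The observation error `e = qhat - (u - v)` has
zero flux at `0` and homogeneous Robin data at `1`, so it sees only the initial data and `f`. Since
`u - v` equals `q` at `0`, the Dirichlet value of `u` becomes `r - e + d0`, and the tracking error
`u - uref` has boundary value `d0 - e` at `0`. At `1` its Robin data is `k i` times the
predecessor's tracking error plus `d1`.

Let `Y i` be the supremum over `[0,t]` of `exp (σ s)` times the tracking error of agent `i` at `x =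
1`. The comparison principle gives `Y i ≤ A + (k i / l) * Y (i-1)` around the cycle. The product of
all gains is less than `1`, so going once around bounds `Y i` by `A * C i`
(`Params.Admissible.le_mul_C`). With this feedback term controlled, barriers for `u`, `v` and
`uref`, together with the bounds on `e` and `u - v`, give the explicit estimate, and `σ = lam / 2`
gives input-to-state stability. -/

namespace MAS

/-! ### Weak derivatives on the unit interval -/

theorem integral_unitMeasure (f : ℝ → ℝ) : ∫ x, f x ∂unitMeasure = ∫ x in (0 : ℝ)..1, f x := by
  rw [intervalIntegral.integral_of_le zero_le_one, integral_Ioc_eq_integral_Ioo]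

theorem intervalIntegrable_of_unitMeasure {f : ℝ → ℝ} (hf : Integrable f unitMeasure) :
    IntervalIntegrable f volume 0 1 := by
  rw [intervalIntegrable_iff_integrableOn_Ioo_of_le zero_le_one]
  exact hf

theorem integrable_of_continuousOn {f : ℝ → ℝ} (hf : ContinuousOn f (Icc 0 1)) :
    Integrable f unitMeasure :=
  (hf.integrableOn_Icc).mono_set Ioo_subset_Icc_self

theorem integrable_mul_of_continuousOn {v φ : ℝ → ℝ} (hv : Integrable v unitMeasure)
    (hφ : ContinuousOn φ (Icc 0 1)) : Integrable (fun x => v x * φ x) unitMeasure := by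
  obtain ⟨c, hc⟩ := isCompact_Icc.exists_bound_of_continuousOn hφ
  refine hv.mul_bdd (c := c) (integrable_of_continuousOn hφ).aestronglyMeasurable ?_
  exact (ae_restrict_mem measurableSet_Ioo).mono fun x hx => hc x (Ioo_subset_Icc_self hx)

/-- The primitive of a test function on `(0,1)` with vanishing integral is a test function. -/
theorem exists_primitive_test {η : ℝ → ℝ} (hη : ContDiff ℝ (⊤ : ℕ∞) η) (hc : HasCompactSupport η)
    (hs : tsupport η ⊆ Ioo (0 : ℝ) 1) (h0 : ∫ x in (0 : ℝ)..1, η x = 0) :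
    ∃ φ : ℝ → ℝ, ContDiff ℝ (⊤ : ℕ∞) φ ∧ HasCompactSupport φ ∧ tsupport φ ⊆ Ioo (0 : ℝ) 1 ∧
      deriv φ = η := by
  obtain ⟨a, b, ha, hb, hab⟩ : ∃ a b : ℝ, 0 < a ∧ b < 1 ∧ tsupport η ⊆ Icc a b := by
    rcases (tsupport η).eq_empty_or_nonempty with h | h
    -- For empty support, the reversed interval `[1,0]` is empty and meets both strict bounds.
    · exact ⟨1, 0, one_pos, zero_lt_one, by simp [h]⟩
    · have hK : IsCompact (tsupport η) := hc
      exact ⟨sInf (tsupport η), sSup (tsupport η), (hs (hK.sInf_mem h)).1, (hs (hK.sSup_mem h)).2,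
        fun x hx => ⟨csInf_le hK.bddBelow hx, le_csSup hK.bddAbove hx⟩⟩
  have hz : ∀ x, x ∉ Icc a b → η x = 0 := fun x hx => image_eq_zero_of_notMem_tsupport
    (fun h => hx (hab h))
  have hd : ∀ x, HasDerivAt (fun x => ∫ y in (0 : ℝ)..x, η y) (η x) x := fun x =>
    hη.continuous.integral_hasStrictDerivAt 0 x |>.hasDerivAt
  have hder : deriv (fun x => ∫ y in (0 : ℝ)..x, η y) = η := funext fun x => (hd x).deriv
  have hsub : tsupport (fun x => ∫ y in (0 : ℝ)..x, η y) ⊆ Icc a b := by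
    refine closure_minimal ?_ isClosed_Icc
    intro x hx
    by_contra hxn
    apply hx
    have hx' : x < a ∨ b < x := by
      by_contra! h
      exact hxn h
    change ∫ y in (0 : ℝ)..x, η y = 0
    have key : ∀ c : ℝ, (∀ y ∈ uIcc c x, y ∉ Icc a b) → ∫ y in c..x, η y = 0 := fun c h => by
      rw [intervalIntegral.integral_congr (g := fun _ => 0) fun y hy => hz y (h y hy)]
      simp
    rcases hx' with h | h
    · refine key 0 fun y hy hy' => ?_
      have := hy.2
      rcases le_max_iff.1 this with h1 | h1 <;> linarith [hy'.1]
    -- To the right of the support the primitive is the full integral over `[0,1]`, which vanishes,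
    -- plus an integral over points beyond `b`.
    · rw [← intervalIntegral.integral_add_adjacent_intervals
        (hη.continuous.intervalIntegrable 0 1) (hη.continuous.intervalIntegrable 1 x), h0, zero_add]
      refine key 1 fun y hy hy' => ?_
      rcases min_le_iff.1 hy.1 with h1 | h1 <;> linarith [hy'.2]
  refine ⟨fun x => ∫ y in (0 : ℝ)..x, η y, ?_, ?_, ?_, hder⟩
  · rw [contDiff_infty_iff_deriv, hder]
    exact ⟨fun x => (hd x).differentiableAt, hη⟩
  · exact isCompact_Icc.of_isClosed_subset (isClosed_tsupport _) hsub
  · exact hsub.trans fun x hx => ⟨ha.trans_le hx.1, hx.2.trans_lt hb⟩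

/-- The lemma of du Bois-Reymond. -/
theorem HasWeakDeriv.ae_const {w : ℝ → ℝ} (hw : Integrable w unitMeasure)
    (h : HasWeakDeriv w 0) : ∃ c, ∀ᵐ x ∂unitMeasure, w x = c := by
  obtain ⟨ρ, hρs, hρc, hρd, hρr, hρ1⟩ := exists_contDiff_tsupport_subset (n := ⊤)
    (Ioo_mem_nhds (show (0 : ℝ) < 1 / 2 by norm_num) (show (1 / 2 : ℝ) < 1 by norm_num))
  have hI : 0 < ∫ x in (0 : ℝ)..1, ρ x := by
    refine intervalIntegral.integral_pos zero_lt_one hρd.continuous.continuousOn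
      (fun x _ => (hρr ⟨x, rfl⟩).1) ⟨1 / 2, by norm_num, by rw [hρ1]; exact one_pos⟩
  set I := ∫ x in (0 : ℝ)..1, ρ x with hIdef
  set c := (∫ x, w x * ρ x ∂unitMeasure) / I with hcdef
  refine ⟨c, ?_⟩
  have hint : ∀ ψ : ℝ → ℝ, Continuous ψ → Integrable (fun x => w x * ψ x) unitMeasure :=
    fun ψ hψ => integrable_mul_of_continuousOn hw hψ.continuousOn
  have hw' : LocallyIntegrableOn (fun x => w x - c) (Ioo 0 1) volume :=
    IntegrableOn.locallyIntegrableOn (hw.sub (integrable_const c))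
  have := isOpen_Ioo.ae_eq_zero_of_integral_contDiff_smul_eq_zero hw' ?_
  · rw [ae_restrict_iff' measurableSet_Ioo]
    filter_upwards [this] with x hx hx1
    linarith [hx hx1]
  intro ψ hψd hψc hψs
  -- Subtracting this multiple of the bump `ρ` makes the integral of `ψ` vanish, so the difference
  -- is the derivative of a test function. The same normalization forces the constant `c` to be the
  -- `ρ`-weighted mean of `w`.
  set m := (∫ x in (0 : ℝ)..1, ψ x) / I with hm
  obtain ⟨φ, h1, h2, h3, h4⟩ := exists_primitive_test (η := fun x => ψ x - m * ρ x)
    (hψd.sub (contDiff_const.mul hρd)) (hψc.sub (hρc.mul_left))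
    ((tsupport_sub _ _).trans (union_subset hψs
      ((closure_mono (Function.support_mul_subset_right _ _)).trans hρs)))
    (by
      rw [intervalIntegral.integral_sub (hψd.continuous.intervalIntegrable _ _)
        ((hρd.continuous.const_mul m).intervalIntegrable _ _),
        intervalIntegral.integral_const_mul, ← hIdef, hm]
      field_simp
      simp)
  have h5 := h φ h1 h2 h3
  rw [h4] at h5
  have h6 : ∫ x, w x * ψ x ∂unitMeasure - m * ∫ x, w x * ρ x ∂unitMeasure = 0 := by
    rw [← integral_const_mul, ← integral_sub (hint ψ hψd.continuous)
      ((hint ρ hρd.continuous).const_mul m)]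
    have : (fun x => w x * ψ x - m * (w x * ρ x)) = fun x => w x * (ψ x - m * ρ x) := by
      ext x; ring
    rw [this, h5]
    simp
  have h7 : ∫ x, ψ x • (w x - c) = ∫ x, (w x * ψ x - c * ψ x) ∂unitMeasure := by
    rw [← setIntegral_eq_integral_of_forall_compl_eq_zero (s := Ioo (0 : ℝ) 1)]
    · refine integral_congr_ae (Eventually.of_forall fun x => ?_)
      simp only [smul_eq_mul]; ring
    · intro x hx
      rw [image_eq_zero_of_notMem_tsupport fun h => hx (hψs h), zero_smul]
  rw [h7, integral_sub (hint ψ hψd.continuous)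
    ((integrable_of_continuousOn hψd.continuous.continuousOn).const_mul c), integral_const_mul,
    integral_unitMeasure ψ]
  have h8 : m * (∫ x, w x * ρ x ∂unitMeasure) = c * ∫ x in (0 : ℝ)..1, ψ x := by
    rw [hm, hcdef]; ring
  linarith

/-- The primitive of `g` is absolutely continuous, so it may be integrated by parts against a test
function, whose endpoint values vanish. Hence `v` minus this primitive has weak derivative zero, and
du Bois-Reymond applies. -/
theorem HasWeakDeriv.ae_eq_primitive {v g : ℝ → ℝ} (hv : Integrable v unitMeasure)
    (hg : Integrable g unitMeasure) (h : HasWeakDeriv v g) :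
    ∃ c, ∀ᵐ x ∂unitMeasure, v x = c + ∫ y in (0 : ℝ)..x, g y := by
  have hgi := intervalIntegrable_of_unitMeasure hg
  have hac := hgi.absolutelyContinuousOnInterval_intervalIntegral (c := 0) (by simp)
  have hcont : ContinuousOn (fun x => ∫ y in (0 : ℝ)..x, g y) (Icc 0 1) := by
    simpa using hac.continuousOn
  have hder : ∀ᵐ x : ℝ, x ∈ uIcc (0 : ℝ) 1 →
      HasDerivAt (fun x => ∫ y in (0 : ℝ)..x, g y) (g x) x := by
    filter_upwards [hgi.ae_hasDerivAt_integral] with x hx hx1 using hx hx1 0 (by simp)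
  obtain ⟨c, hc⟩ := HasWeakDeriv.ae_const
    (w := fun x => v x - ∫ y in (0 : ℝ)..x, g y) (hv.sub (integrable_of_continuousOn hcont)) (by
    intro φ h1 h2 h3
    have hφac : AbsolutelyContinuousOnInterval φ 0 1 :=
      (h1.of_le (by simp)).contDiffOn.absolutelyContinuousOnInterval
    have e0 : φ 0 = 0 := image_eq_zero_of_notMem_tsupport fun h => lt_irrefl _ (h3 h).1
    have e1 : φ 1 = 0 := image_eq_zero_of_notMem_tsupport fun h => lt_irrefl _ (h3 h).2
    have e2 := hac.integral_mul_deriv_eq_deriv_mul hφac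
    have e3 : ∫ x in (0 : ℝ)..1, deriv (fun x => ∫ y in (0 : ℝ)..x, g y) x * φ x
        = ∫ x in (0 : ℝ)..1, g x * φ x := by
      refine intervalIntegral.integral_congr_ae ?_
      filter_upwards [hder] with x hx hx1
      rw [(hx (uIoc_subset_uIcc hx1)).deriv]
    have hφ' : Continuous (deriv φ) := h1.continuous_deriv (by simp)
    have e4 := h φ h1 h2 h3
    change ∫ x, _ ∂unitMeasure = -∫ x, _ ∂unitMeasure
    change ∫ x, _ ∂unitMeasure = -∫ x, _ ∂unitMeasure at e4
    simp only [sub_mul]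
    rw [integral_sub (integrable_mul_of_continuousOn hv hφ'.continuousOn)
      (integrable_mul_of_continuousOn (integrable_of_continuousOn hcont) hφ'.continuousOn), e4,
      integral_unitMeasure, integral_unitMeasure, e2, e3, e0, e1]
    simp)
  exact ⟨c, hc.mono fun x hx => by linarith⟩

/-! ### Functions of class `H²` and integration by parts -/

theorem L2.integrable (a : L2) : Integrable (a : ℝ → ℝ) unitMeasure :=
  (Lp.memLp a).integrable (by norm_num)

/-- The structure of a function of class `H²(0,1)`. -/
structure IsH2 (v p h : ℝ → ℝ) : Prop where
  hasDerivWithinAt : ∀ x ∈ Icc (0 : ℝ) 1, HasDerivWithinAt v (p x) (Icc 0 1) x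
  ac : AbsolutelyContinuousOnInterval p 0 1
  ae_hasDerivAt : ∀ᵐ x ∂unitMeasure, HasDerivAt p (h x) x

/-- Two applications of the primitive representation give `p` as a primitive of `Uxx t`, and
`u(·,t)` almost everywhere as a primitive of `p`. Continuity of the slice upgrades this to all of
`[0,1]`, so the one-sided derivatives in the boundary conditions are values of the continuous
function `p`. -/
theorem IsH2Curve.exists_isH2 {u : ℝ → ℝ → ℝ} {U Ux Uxx : ℝ → L2} (H : IsH2Curve u U Ux Uxx)
    {t : ℝ} (ht : 0 ≤ t) :
    ∃ p, IsH2 (fun x => u x t) p (Uxx t) ∧ ∀ᵐ x ∂unitMeasure, (Ux t : ℝ → ℝ) x = p x := by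
  obtain ⟨c1, hc1⟩ := (H.weakDeriv_two t ht).ae_eq_primitive (L2.integrable _) (L2.integrable _)
  obtain ⟨c0, hc0⟩ := (H.weakDeriv_one t ht).ae_eq_primitive (L2.integrable _) (L2.integrable _)
  have hgi := intervalIntegrable_of_unitMeasure (L2.integrable (Uxx t))
  set p : ℝ → ℝ := fun x => c1 + ∫ y in (0 : ℝ)..x, (Uxx t : ℝ → ℝ) y with hp
  have hac : AbsolutelyContinuousOnInterval p 0 1 :=
    AbsolutelyContinuousOnInterval.add
      (contDiffOn_const (c := c1)).absolutelyContinuousOnInterval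
      (hgi.absolutelyContinuousOnInterval_intervalIntegral (c := 0) (by simp))
  have hpc : ContinuousOn p (Icc 0 1) := by simpa using hac.continuousOn
  have hpi : IntervalIntegrable p volume 0 1 :=
    intervalIntegrable_of_unitMeasure (integrable_of_continuousOn hpc)
  have hPc : ContinuousOn (fun x => c0 + ∫ y in (0 : ℝ)..x, p y) (Icc 0 1) := by
    have := (hpi.absolutelyContinuousOnInterval_intervalIntegral (c := 0) (by simp)).continuousOn
    exact continuousOn_const.add (by simpa using this)
  have hae : ∀ᵐ x ∂unitMeasure, u x t = c0 + ∫ y in (0 : ℝ)..x, p y := by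
    filter_upwards [H.represents t ht, hc0, ae_restrict_mem measurableSet_Ioo] with x h1 h2 hx
    rw [← h1, h2]
    congr 1
    refine intervalIntegral.integral_congr_ae ?_
    rw [ae_restrict_iff' measurableSet_Ioo] at hc1
    have hne : ∀ᵐ y : ℝ, y ≠ x := by
      simp [ae_iff, measure_singleton]
    filter_upwards [hc1] with y hy hyx
    rw [uIoc_of_le hx.1.le] at hyx
    exact hy ⟨hyx.1, hyx.2.trans_lt hx.2⟩
  have heq : EqOn (fun x => u x t) (fun x => c0 + ∫ y in (0 : ℝ)..x, p y) (Icc 0 1) := by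
    refine Measure.eqOn_Icc_of_ae_eq volume zero_ne_one ?_ (H.continuousOn_slice t ht) hPc
    rw [← Measure.restrict_congr_set Ioo_ae_eq_Icc]
    exact hae
  refine ⟨p, ⟨fun x hx => ?_, hac, ?_⟩, hc1⟩
  · refine HasDerivWithinAt.congr_of_mem ?_ heq hx
    refine HasDerivWithinAt.const_add _ ?_
    have : Fact (x ∈ Icc (0 : ℝ) 1) := ⟨hx⟩
    exact intervalIntegral.integral_hasDerivWithinAt_right
      (hpi.mono_set (by rw [uIcc_of_le hx.1, uIcc_of_le zero_le_one]; exact Icc_subset_Icc_right hx.2))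
      (hpc.stronglyMeasurableAtFilter_nhdsWithin measurableSet_Icc x) (hpc x hx)
  · rw [ae_restrict_iff' measurableSet_Ioo]
    filter_upwards [hgi.ae_hasDerivAt_integral] with x hx hx1
    exact (hx (by simpa using Ioo_subset_Icc_self hx1) 0 (by simp)).const_add c1

theorem IsH2.continuousOn {v p h : ℝ → ℝ} (H : IsH2 v p h) : ContinuousOn v (Icc 0 1) :=
  fun x hx => (H.hasDerivWithinAt x hx).continuousWithinAt

theorem IsH2.continuousOn_deriv {v p h : ℝ → ℝ} (H : IsH2 v p h) : ContinuousOn p (Icc 0 1) := by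
  simpa using H.ac.continuousOn

theorem IsH2.xDeriv_eq {v p h : ℝ → ℝ} (H : IsH2 v p h) {x : ℝ} (hx : x ∈ Icc (0 : ℝ) 1) :
    xDeriv v x = p x :=
  (H.hasDerivWithinAt x hx).derivWithin (uniqueDiffOn_Icc zero_lt_one x hx)

theorem IsH2.hasDerivAt {v p h : ℝ → ℝ} (H : IsH2 v p h) {x : ℝ} (hx : x ∈ Ioo (0 : ℝ) 1) :
    HasDerivAt v (p x) x :=
  (H.hasDerivWithinAt x (Ioo_subset_Icc_self hx)).hasDerivAt (Icc_mem_nhds hx.1 hx.2)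

/-- Integration by parts against the positive part of `v - m`. -/
theorem IsH2.integral_posPart_mul_le {v p h : ℝ → ℝ} (H : IsH2 v p h) (m : ℝ) :
    ∫ x, max (v x - m) 0 * h x ∂unitMeasure
      ≤ max (v 1 - m) 0 * p 1 - max (v 0 - m) 0 * p 0 := by
  obtain ⟨K, hK⟩ := isCompact_Icc.exists_bound_of_continuousOn H.continuousOn_deriv
  -- A bounded derivative makes `v` Lipschitz. Truncation preserves this, so the positive part is
  -- absolutely continuous.
  have hlip : LipschitzOnWith K.toNNReal v (Icc 0 1) :=
    (convex_Icc 0 1).lipschitzOnWith_of_nnnorm_hasDerivWithin_le H.hasDerivWithinAt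
      fun x hx => NNReal.le_toNNReal_of_coe_le (hK x hx)
  have hψ : AbsolutelyContinuousOnInterval (fun x => max (v x - m) 0) 0 1 := by
    refine LipschitzOnWith.absolutelyContinuousOnInterval (K := K.toNNReal) ?_
    rw [uIcc_of_le zero_le_one]
    refine LipschitzOnWith.of_dist_le_mul fun x hx y hy => ?_
    refine le_trans ?_ (hlip.dist_le_mul x hx y hy)
    rw [Real.dist_eq, Real.dist_eq]
    refine (abs_max_sub_max_le_abs _ _ _).trans ?_
    simp
  have e1 := hψ.integral_mul_deriv_eq_deriv_mul H.ac
  have e2 : ∫ x, max (v x - m) 0 * h x ∂unitMeasure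
      = ∫ x, max (v x - m) 0 * deriv p x ∂unitMeasure :=
    integral_congr_ae (H.ae_hasDerivAt.mono fun x hx => by simp only [hx.deriv])
  have e3 : 0 ≤ ∫ x, deriv (fun x => max (v x - m) 0) x * p x ∂unitMeasure := by
    refine integral_nonneg_of_ae ((ae_restrict_mem measurableSet_Ioo).mono fun x hx => ?_)
    have hd := (H.hasDerivAt hx).sub_const m
    rcases lt_trichotomy (v x - m) 0 with h1 | h1 | h1
    · have : (fun x => max (v x - m) 0) =ᶠ[𝓝 x] fun _ => 0 :=
        (hd.continuousAt.eventually (gt_mem_nhds h1)).mono fun y hy => max_eq_right hy.le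
      simp [this.deriv_eq]
    -- Where `v = m` the truncation attains its minimum `0`. Its `deriv` is therefore `0`, by
    -- convention if it is not differentiable there.
    · have : IsLocalMin (fun x => max (v x - m) 0) x :=
        Eventually.of_forall fun y => by simp [h1]
      simp [this.deriv_eq_zero]
    · have : (fun x => max (v x - m) 0) =ᶠ[𝓝 x] fun x => v x - m :=
        (hd.continuousAt.eventually (lt_mem_nhds h1)).mono fun y hy => max_eq_left hy.le
      simp only [this.deriv_eq, hd.deriv]
      exact mul_self_nonneg _
  rw [e2, integral_unitMeasure, e1]
  rw [integral_unitMeasure] at e3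
  linarith

/-! ### The squared norm of the positive part on `L²` -/

theorem L2.inner_eq (a b : L2) : inner ℝ a b = ∫ x, (a : ℝ → ℝ) x * (b : ℝ → ℝ) x ∂unitMeasure := by
  rw [MeasureTheory.L2.inner_def]
  refine integral_congr_ae (Eventually.of_forall fun x => ?_)
  simp [mul_comm]

theorem L2.integrable_mul (a b : L2) :
    Integrable (fun x => (a : ℝ → ℝ) x * (b : ℝ → ℝ) x) unitMeasure := by
  refine (MeasureTheory.L2.integrable_inner (𝕜 := ℝ) a b).congr (Eventually.of_forall fun x => ?_)
  simp [mul_comm]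

/-- The function `s ↦ (max s 0)²` has the Lipschitz derivative `2 * max s 0`, so its first-order
Taylor remainder is quadratic although the positive part itself has a kink. -/
theorem sq_posPart_taylor (a b : ℝ) :
    |max b 0 * max b 0 - max a 0 * max a 0 - 2 * (max a 0 * (b - a))| ≤ (b - a) * (b - a) := by
  rw [abs_le]
  rcases le_total a 0 with ha | ha <;> rcases le_total b 0 with hb | hb <;>
    simp only [ha, hb, max_eq_left, max_eq_right] <;> constructor <;> nlinarith

theorem L2.abs_posPart_taylor (a b : L2) :
    |‖Lp.posPart b‖ ^ 2 - ‖Lp.posPart a‖ ^ 2 - 2 * inner ℝ (Lp.posPart a) (b - a)|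
      ≤ ‖b - a‖ ^ 2 := by
  simp only [← real_inner_self_eq_norm_sq, L2.inner_eq]
  have hsub : Integrable (fun x => (Lp.posPart b : ℝ → ℝ) x * (Lp.posPart b : ℝ → ℝ) x
      - (Lp.posPart a : ℝ → ℝ) x * (Lp.posPart a : ℝ → ℝ) x) unitMeasure :=
    (L2.integrable_mul _ _).sub (L2.integrable_mul _ _)
  rw [← integral_const_mul, ← integral_sub (L2.integrable_mul _ _) (L2.integrable_mul _ _),
    ← integral_sub hsub ((L2.integrable_mul _ _).const_mul 2)]
  refine (abs_integral_le_integral_abs).trans (integral_mono_ae ?_ (L2.integrable_mul _ _) ?_)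
  · exact (hsub.sub ((L2.integrable_mul _ _).const_mul 2)).abs
  · filter_upwards [Lp.coeFn_posPart a, Lp.coeFn_posPart b, Lp.coeFn_sub b a] with x h1 h2 h3
    simp only [h1, h2, h3, Pi.sub_apply]
    exact sq_posPart_taylor _ _

/-- The pointwise Taylor remainder integrates to at most `‖b - a‖ ^ 2`, which is `o(‖b - a‖)`. This
supplies the chain rule for the energy in the maximum principle. -/
theorem L2.hasFDerivAt_norm_posPart_sq (a : L2) :
    HasFDerivAt (fun b : L2 => ‖Lp.posPart b‖ ^ 2) ((2 : ℝ) • innerSL ℝ (Lp.posPart a)) a := by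
  refine HasFDerivAt.of_isLittleO (Asymptotics.isLittleO_iff.2 fun c hc => ?_)
  filter_upwards [Metric.ball_mem_nhds a hc] with b hb
  have h := L2.abs_posPart_taylor a b
  have hb' : ‖b - a‖ < c := by rwa [← dist_eq_norm]
  simp only [FunLike.coe_smul, Pi.smul_apply, innerSL_apply_apply, smul_eq_mul, Real.norm_eq_abs]
  refine h.trans ?_
  rw [sq]
  exact mul_le_mul_of_nonneg_right hb'.le (norm_nonneg _)

/-! ### The maximum principle -/

theorem IsH2Curve.hasDerivAt {u : ℝ → ℝ → ℝ} {U Ux Uxx : ℝ → L2} (H : IsH2Curve u U Ux Uxx)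
    {t : ℝ} (ht : 0 < t) : HasDerivAt U (deriv U t) t :=
  ((H.contDiffOn_time.differentiableOn (by simp) t ht.le).differentiableAt
    (Ici_mem_nhds ht)).hasDerivAt

/-- The maximum principle, with the spatially constant barrier `G * exp (-σ t)`. -/
theorem SolvesPDE.le_barrier {α lam l σ G T : ℝ} {f y : ℝ → ℝ → ℝ} (hy : SolvesPDE α lam f y)
    (hα : 0 < α) (hlam : 0 ≤ lam) (hl : 0 ≤ l)
    (hf : ∀ t ∈ Ioc 0 T, ∀ x ∈ Ioo (0 : ℝ) 1, f x t ≤ (lam - σ) * (G * Real.exp (-σ * t)))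
    (h0 : ∀ x ∈ Ioo (0 : ℝ) 1, y x 0 ≤ G)
    (hleft : ∀ t ∈ Ioc 0 T, y 0 t ≤ G * Real.exp (-σ * t) ∨ xDeriv (fun x => y x t) 0 = 0)
    (hright : ∀ t ∈ Ioc 0 T, xDeriv (fun x => y x t) 1 ≤ l * (G * Real.exp (-σ * t) - y 1 t)) :
    ∀ t ∈ Icc 0 T, ∀ x ∈ Icc (0 : ℝ) 1, y x t ≤ G * Real.exp (-σ * t) := by
  obtain ⟨U, Ux, Uxx, H, hpde⟩ := hy
  set m : ℝ → ℝ := fun t => G * Real.exp (-σ * t) with hm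
  have hmd : ∀ t, HasDerivAt m (-σ * m t) t := fun t => by
    refine ((((hasDerivAt_id t).const_mul (-σ)).exp).const_mul G).congr_deriv ?_
    change G * (Real.exp (-σ * t) * (-σ * 1)) = -σ * (G * Real.exp (-σ * t))
    ring
  set one : L2 := Lp.const 2 unitMeasure (1 : ℝ) with hone
  have hone_ae : ∀ᵐ x ∂unitMeasure, (one : ℝ → ℝ) x = 1 := by
    filter_upwards [Lp.coeFn_const (p := 2) (μ := unitMeasure) (1 : ℝ)] with x hx
    rw [hone, hx]; rfl
  set W : ℝ → L2 := fun t => U t - m t • one with hW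
  have hWae : ∀ t, 0 ≤ t →
      ∀ᵐ x ∂unitMeasure, (Lp.posPart (W t) : ℝ → ℝ) x = max (y x t - m t) 0 := fun t ht => by
    filter_upwards [Lp.coeFn_posPart (W t), Lp.coeFn_sub (U t) (m t • one),
      Lp.coeFn_smul (m t) one, hone_ae, H.represents t ht] with x h1 h2 h3 h4 h5
    rw [h1, hW, h2, Pi.sub_apply, h3, Pi.smul_apply, h4, h5, smul_eq_mul, mul_one]
  have hWd : ∀ t, 0 < t → HasDerivAt W (deriv U t - (-σ * m t) • one) t := fun t ht =>
    (H.hasDerivAt ht).sub ((hmd t).smul_const one)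
  have hΦd : ∀ t, 0 < t → HasDerivAt (fun t => ‖Lp.posPart (W t)‖ ^ 2)
      (2 * inner ℝ (Lp.posPart (W t)) (deriv U t - (-σ * m t) • one)) t := fun t ht => by
    have := (L2.hasFDerivAt_norm_posPart_sq (W t)).comp_hasDerivAt t (hWd t ht)
    simpa using! this
  have hWc : ContinuousOn W (Ici 0) := by
    refine H.continuousOn_zero.sub (Continuous.continuousOn ?_)
    exact (continuous_iff_continuousAt.2 fun t => (hmd t).continuousAt).smul continuous_const
  have hΦc : ContinuousOn (fun t => ‖Lp.posPart (W t)‖ ^ 2) (Ici 0) :=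
    ((Lp.continuous_posPart.comp_continuousOn hWc).norm).pow 2
  -- Energy dissipation: the reaction and source terms have the right sign where `y > m`, and
  -- integrating the diffusion term by parts leaves only nonpositive boundary terms.
  have hneg : ∀ t ∈ Ioc 0 T,
      inner ℝ (Lp.posPart (W t)) (deriv U t - (-σ * m t) • one) ≤ 0 := fun t ht => by
    obtain ⟨p, hp, -⟩ := H.exists_isH2 ht.1.le
    have hψ : ContinuousOn (fun x => max (y x t - m t) 0) (Icc 0 1) :=
      (hp.continuousOn.sub continuousOn_const).sup continuousOn_const
    have hbd := hp.integral_posPart_mul_le (m t)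
    have hb1 : max (y 1 t - m t) 0 * p 1 ≤ 0 := by
      have h1 := hright t ht
      rw [hp.xDeriv_eq (by simp)] at h1
      rcases le_total (y 1 t - m t) 0 with h2 | h2
      · simp [h2]
      · rw [max_eq_left h2]
        refine mul_nonpos_of_nonneg_of_nonpos h2 (h1.trans ?_)
        exact mul_nonpos_of_nonneg_of_nonpos hl (by simp only [hm] at h2 ⊢; linarith)
    -- Either boundary condition removes this term: a Dirichlet bound kills the truncation, a
    -- Neumann condition kills the flux.
    have hb0 : max (y 0 t - m t) 0 * p 0 = 0 := by
      rcases hleft t ht with h1 | h1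
      · rw [max_eq_right (by simp only [hm]; linarith), zero_mul]
      · rw [hp.xDeriv_eq (by simp)] at h1
        rw [h1, mul_zero]
    have hint : Integrable (fun x => max (y x t - m t) 0 * (Uxx t : ℝ → ℝ) x) unitMeasure :=
      (integrable_mul_of_continuousOn (L2.integrable (Uxx t)) hψ).congr
        (Eventually.of_forall fun x => mul_comm _ _)
    rw [L2.inner_eq]
    calc _ ≤ ∫ x, α * (max (y x t - m t) 0 * (Uxx t : ℝ → ℝ) x) ∂unitMeasure := by
          refine integral_mono_ae (L2.integrable_mul _ _) (hint.const_mul α) ?_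
          filter_upwards [hWae t ht.1.le, Lp.coeFn_sub (deriv U t) ((-σ * m t) • one),
            Lp.coeFn_smul (-σ * m t) one, hone_ae, hpde t ht.1,
            ae_restrict_mem measurableSet_Ioo] with x h1 h2 h3 h4 h5 h6
          rw [h1, h2, Pi.sub_apply, h3, Pi.smul_apply, h4, h5, smul_eq_mul, mul_one]
          have h7 := hf t ht x h6
          change f x t ≤ (lam - σ) * m t at h7
          rcases le_total (y x t - m t) 0 with h8 | h8
          · simp [h8]
          · rw [max_eq_left h8]
            have h9 : 0 ≤ lam * (y x t - m t) := mul_nonneg hlam h8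
            -- Since `f ≤ (lam - σ) * m`, the left side is at most `-lam * (y - m)`.
            have h10 : -lam * y x t + f x t + σ * m t ≤ 0 := by linarith
            have := mul_nonpos_of_nonneg_of_nonpos h8 h10
            linarith
      _ = α * ∫ x, max (y x t - m t) 0 * (Uxx t : ℝ → ℝ) x ∂unitMeasure := integral_const_mul _ _
      _ ≤ 0 := mul_nonpos_of_nonneg_of_nonpos hα.le (by linarith)
  have hanti : AntitoneOn (fun t => ‖Lp.posPart (W t)‖ ^ 2) (Icc 0 T) := by
    refine antitoneOn_of_deriv_nonpos (convex_Icc 0 T) (hΦc.mono Icc_subset_Ici_self) ?_ ?_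
    · rw [interior_Icc]
      exact fun t ht => (hΦd t ht.1).differentiableAt.differentiableWithinAt
    · rw [interior_Icc]
      intro t ht
      rw [(hΦd t ht.1).deriv]
      linarith [hneg t ⟨ht.1, ht.2.le⟩]
  have hΦ0 : Lp.posPart (W 0) = 0 := by
    refine Lp.eq_zero_iff_ae_eq_zero.2 ?_
    filter_upwards [hWae 0 le_rfl, ae_restrict_mem measurableSet_Ioo] with x h1 h2
    rw [h1]
    refine max_eq_right ?_
    have := h0 x h2
    simp only [hm, mul_zero, Real.exp_zero, mul_one]
    linarith
  intro t ht x hx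
  have h1 := hanti ⟨le_rfl, ht.1.trans ht.2⟩ ht ht.1
  simp only [hΦ0, norm_zero] at h1
  have h2 : Lp.posPart (W t) = 0 := by
    rw [← norm_eq_zero]
    exact pow_eq_zero_iff (two_ne_zero) |>.1 (le_antisymm (by simpa using h1) (sq_nonneg _))
  -- The energy controls `y` only almost everywhere. Continuity of the slice gives every point,
  -- including the end points used later as boundary values.
  have h3 : EqOn (fun x => max (y x t - m t) 0) (fun _ => 0) (Icc 0 1) := by
    refine Measure.eqOn_Icc_of_ae_eq volume zero_ne_one ?_
      (((H.continuousOn_slice t ht.1).sub continuousOn_const).sup continuousOn_const)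
      continuousOn_const
    rw [← Measure.restrict_congr_set Ioo_ae_eq_Icc]
    filter_upwards [hWae t ht.1, Lp.eq_zero_iff_ae_eq_zero.1 h2] with x h4 h5
    rw [← h4, h5]; rfl
  have := h3 hx
  simp only [max_eq_right_iff] at this
  simp only [hm] at this
  linarith

/-! ### Superposition, boundary values and two-sided bounds -/

theorem L2.coeFn_lincomb (a b : ℝ) (v w : L2) :
    ∀ᵐ x ∂unitMeasure, ((a • v + b • w : L2) : ℝ → ℝ) x = a * (v : ℝ → ℝ) x + b * (w : ℝ → ℝ) x := by
  filter_upwards [Lp.coeFn_add (a • v) (b • w), Lp.coeFn_smul a v, Lp.coeFn_smul b w]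
    with x h1 h2 h3
  rw [h1, Pi.add_apply, h2, h3]
  rfl

theorem L2.integral_lincomb_mul (a b : ℝ) (v w : L2) {φ : ℝ → ℝ} (hφ : Continuous φ) :
    ∫ x, ((a • v + b • w : L2) : ℝ → ℝ) x * φ x ∂unitMeasure
      = a * ∫ x, (v : ℝ → ℝ) x * φ x ∂unitMeasure + b * ∫ x, (w : ℝ → ℝ) x * φ x ∂unitMeasure := by
  have hi : ∀ z : L2, Integrable (fun x => (z : ℝ → ℝ) x * φ x) unitMeasure := fun z =>
    integrable_mul_of_continuousOn (L2.integrable z) hφ.continuousOn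
  rw [← integral_const_mul, ← integral_const_mul,
    ← integral_add ((hi v).const_mul a) ((hi w).const_mul b)]
  refine integral_congr_ae ?_
  filter_upwards [L2.coeFn_lincomb a b v w] with x hx
  rw [hx]; ring

theorem HasWeakDeriv.lincomb {v g w h : L2} (a b : ℝ) (hv : HasWeakDeriv v g)
    (hw : HasWeakDeriv w h) : HasWeakDeriv (a • v + b • w : L2) (a • g + b • h : L2) := by
  intro φ h1 h2 h3
  have e1 := hv φ h1 h2 h3
  have e2 := hw φ h1 h2 h3
  change ∫ x, _ ∂unitMeasure = -∫ x, _ ∂unitMeasure at e1 e2 ⊢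
  rw [L2.integral_lincomb_mul a b v w (h1.continuous_deriv (by simp)),
    L2.integral_lincomb_mul a b g h h1.continuous, e1, e2]
  ring

theorem SolvesPDE.lincomb {α lam : ℝ} {f g u v : ℝ → ℝ → ℝ} (a b : ℝ)
    (hu : SolvesPDE α lam f u) (hv : SolvesPDE α lam g v) :
    SolvesPDE α lam (fun x t => a * f x t + b * g x t) (fun x t => a * u x t + b * v x t) := by
  obtain ⟨U, Ux, Uxx, H, hU⟩ := hu
  obtain ⟨V, Vx, Vxx, K, hV⟩ := hv
  refine ⟨fun t => a • U t + b • V t, fun t => a • Ux t + b • Vx t,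
    fun t => a • Uxx t + b • Vxx t, ⟨?_, ?_, ?_, ?_, ?_, ?_, ?_, ?_⟩, ?_⟩
  · exact fun t ht => ((H.continuousOn_slice t ht).const_mul a).add
      ((K.continuousOn_slice t ht).const_mul b)
  · intro t ht
    filter_upwards [L2.coeFn_lincomb a b (U t) (V t), H.represents t ht, K.represents t ht]
      with x h1 h2 h3
    rw [h1, h2, h3]
  · exact fun t ht => (H.weakDeriv_one t ht).lincomb a b (K.weakDeriv_one t ht)
  · exact fun t ht => (H.weakDeriv_two t ht).lincomb a b (K.weakDeriv_two t ht)
  · exact (H.continuousOn_zero.const_smul a).add (K.continuousOn_zero.const_smul b)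
  · exact (H.continuousOn_one.const_smul a).add (K.continuousOn_one.const_smul b)
  · exact (H.continuousOn_two.const_smul a).add (K.continuousOn_two.const_smul b)
  · exact (H.contDiffOn_time.const_smul a).add (K.contDiffOn_time.const_smul b)
  · intro t ht
    have hd : deriv (fun t => a • U t + b • V t) t = a • deriv U t + b • deriv V t :=
      (((H.hasDerivAt ht).const_smul a).add ((K.hasDerivAt ht).const_smul b)).deriv
    rw [hd]
    filter_upwards [L2.coeFn_lincomb a b (deriv U t) (deriv V t),
      L2.coeFn_lincomb a b (Uxx t) (Vxx t), hU t ht, hV t ht] with x h1 h2 h3 h4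
    rw [h1, h2, h3, h4]
    ring

theorem SolvesPDE.neg {α lam : ℝ} {f u : ℝ → ℝ → ℝ} (hu : SolvesPDE α lam f u) :
    SolvesPDE α lam (fun x t => -f x t) (fun x t => -u x t) := by
  simpa using hu.lincomb (-1) 0 hu

theorem SolvesPDE.sub {α lam : ℝ} {f g u v : ℝ → ℝ → ℝ} (hu : SolvesPDE α lam f u)
    (hv : SolvesPDE α lam g v) :
    SolvesPDE α lam (fun x t => f x t - g x t) (fun x t => u x t - v x t) := by
  simpa [sub_eq_add_neg] using hu.lincomb 1 (-1) hv

theorem SolvesPDE.continuousOn_slice {α lam : ℝ} {f u : ℝ → ℝ → ℝ} (hu : SolvesPDE α lam f u)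
    {t : ℝ} (ht : 0 ≤ t) : ContinuousOn (fun x => u x t) (Icc 0 1) := by
  obtain ⟨U, Ux, Uxx, H, -⟩ := hu
  exact H.continuousOn_slice t ht

theorem SolvesPDE.differentiableOn_slice {α lam : ℝ} {f u : ℝ → ℝ → ℝ}
    (hu : SolvesPDE α lam f u) {t : ℝ} (ht : 0 ≤ t) :
    DifferentiableOn ℝ (fun x => u x t) (Icc 0 1) := by
  obtain ⟨U, Ux, Uxx, H, -⟩ := hu
  obtain ⟨p, hp, -⟩ := H.exists_isH2 ht
  exact fun x hx => (hp.hasDerivWithinAt x hx).differentiableWithinAt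

theorem xDeriv_sub {g h : ℝ → ℝ} (hg : DifferentiableOn ℝ g (Icc 0 1))
    (hh : DifferentiableOn ℝ h (Icc 0 1)) {x : ℝ} (hx : x ∈ Icc (0 : ℝ) 1) :
    xDeriv (fun y => g y - h y) x = xDeriv g x - xDeriv h x :=
  derivWithin_fun_sub (hg x hx) (hh x hx)

theorem xDeriv_neg (g : ℝ → ℝ) (x : ℝ) : xDeriv (fun y => -g y) x = -xDeriv g x :=
  derivWithin.fun_neg

/-- Boundary values of a solution depend continuously on time. -/
theorem SolvesPDE.continuousOn_right {α lam : ℝ} {f u : ℝ → ℝ → ℝ} (hu : SolvesPDE α lam f u) :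
    ContinuousOn (fun t => u 1 t) (Ici 0) := by
  obtain ⟨U, Ux, Uxx, H, -⟩ := hu
  have hmem : MemLp (fun x : ℝ => x) 2 unitMeasure := by
    refine MemLp.of_bound (C := 1) continuous_id.aestronglyMeasurable ?_
    filter_upwards [ae_restrict_mem measurableSet_Ioo] with x hx
    rw [Real.norm_eq_abs, abs_of_pos hx.1]
    exact hx.2.le
  have hone : ∀ᵐ x ∂unitMeasure, (Lp.const 2 unitMeasure (1 : ℝ) : ℝ → ℝ) x = 1 := by
    filter_upwards [Lp.coeFn_const (p := 2) (μ := unitMeasure) (1 : ℝ)] with x hx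
    rw [hx]; rfl
  -- Integrating `(x * u)' = u + x * u_x` over `(0,1)` writes the trace at `1` through inner
  -- products of `U t` and `Ux t` with fixed elements of `L²`.
  have key : ∀ t ∈ Ici (0 : ℝ), u 1 t
      = inner ℝ (Lp.const 2 unitMeasure (1 : ℝ)) (U t) + inner ℝ (hmem.toLp _) (Ux t) := by
    intro t ht
    obtain ⟨p, hp, hUx⟩ := H.exists_isH2 ht
    have hi : Integrable (fun x => u x t + x * p x) unitMeasure :=
      integrable_of_continuousOn (hp.continuousOn.add (continuousOn_id.mul hp.continuousOn_deriv))
    have hftc := intervalIntegral.integral_eq_sub_of_hasDerivAt_of_le (zero_le_one (α := ℝ))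
      (f := fun x => x * u x t) (f' := fun x => u x t + x * p x)
      (continuousOn_id.mul hp.continuousOn) (fun x hx => by
        simpa using (hasDerivAt_id' x).fun_mul (hp.hasDerivAt hx)) (intervalIntegrable_of_unitMeasure hi)
    rw [← integral_unitMeasure] at hftc
    simp only [one_mul, zero_mul, sub_zero] at hftc
    rw [L2.inner_eq, L2.inner_eq, ← hftc,
      ← integral_add (L2.integrable_mul _ _) (L2.integrable_mul _ _)]
    refine integral_congr_ae ?_
    filter_upwards [hone, hmem.coeFn_toLp, H.represents t ht, hUx] with x h1 h2 h3 h4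
    rw [h1, h2, h3, h4, one_mul]
  refine ContinuousOn.congr ?_ key
  exact (continuousOn_const.inner H.continuousOn_zero).add
    (continuousOn_const.inner H.continuousOn_one)

/-- The two-sided maximum principle. -/
theorem SolvesPDE.abs_le_barrier {α lam l σ G T : ℝ} {f y : ℝ → ℝ → ℝ} {g : ℝ → ℝ}
    (hy : SolvesPDE α lam f y) (hα : 0 < α) (hlam : 0 ≤ lam) (hl : 0 ≤ l)
    (hf : ∀ t ∈ Ioc 0 T, ∀ x ∈ Ioo (0 : ℝ) 1, |f x t| ≤ (lam - σ) * (G * Real.exp (-σ * t)))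
    (h0 : ∀ x ∈ Ioo (0 : ℝ) 1, |y x 0| ≤ G)
    (hleft : ∀ t ∈ Ioc 0 T, |y 0 t| ≤ G * Real.exp (-σ * t) ∨ xDeriv (fun x => y x t) 0 = 0)
    (hright : ∀ t ∈ Ioc 0 T, xDeriv (fun x => y x t) 1 = -l * y 1 t + g t)
    (hg : ∀ t ∈ Ioc 0 T, |g t| ≤ l * (G * Real.exp (-σ * t))) :
    ∀ t ∈ Icc 0 T, ∀ x ∈ Icc (0 : ℝ) 1, |y x t| ≤ G * Real.exp (-σ * t) := by
  have h1 := hy.le_barrier hα hlam hl (fun t ht x hx => (abs_le.1 (hf t ht x hx)).2)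
    (fun x hx => (abs_le.1 (h0 x hx)).2)
    (fun t ht => (hleft t ht).imp_left fun h => (abs_le.1 h).2)
    (fun t ht => by rw [hright t ht]; linarith [(abs_le.1 (hg t ht)).2])
  have h2 := hy.neg.le_barrier (σ := σ) (G := G) hα hlam hl
    (fun t ht x hx => by linarith [(abs_le.1 (hf t ht x hx)).1])
    (fun x hx => by linarith [(abs_le.1 (h0 x hx)).1])
    (fun t ht => (hleft t ht).imp (fun h => by linarith [(abs_le.1 h).1])
      (fun h => by rw [xDeriv_neg, h, neg_zero]))
    (fun t ht => by rw [xDeriv_neg, hright t ht]; linarith [(abs_le.1 (hg t ht)).1])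
  exact fun t ht x hx => abs_le.2 ⟨by linarith [h2 t ht x hx], h1 t ht x hx⟩

/-! ### Cyclic gain products and the small-gain estimate -/

theorem prev_mem {N i : ℕ} (hi : i ∈ Icc 1 N) : prev N i ∈ Icc 1 N := by
  obtain ⟨h1, h2⟩ := hi
  unfold prev
  split_ifs <;> constructor <;> omega

theorem prev_succ {N i : ℕ} (hi : 1 ≤ i) : prev N (i + 1) = i := by
  unfold prev
  split_ifs <;> omega

/-- The product of the `m` normalized gains with indices `i, i - 1, …, i - m + 1`. -/
noncomputable def Params.chain (P : Params) (i m : ℕ) : ℝ := ∏ r ∈ Finset.range m, P.k (i - r) / P.l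

namespace Params

variable {P : Params}

theorem chain_eq (i m : ℕ) : P.chain i m = (∏ r ∈ Finset.range m, P.k (i - r)) / P.l ^ m := by
  simp [chain, Finset.prod_div_distrib]

@[simp] theorem chain_zero (i : ℕ) : P.chain i 0 = 1 := by simp [chain]

theorem chain_succ (i m : ℕ) : P.chain i (m + 1) = P.chain i m * (P.k (i - m) / P.l) :=
  Finset.prod_range_succ _ _

theorem chain_succ' (i m : ℕ) :
    P.chain (i + 1) (m + 1) = P.k (i + 1) / P.l * P.chain i m := by
  rw [chain, Finset.prod_range_succ', mul_comm]
  simp [chain]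

/-- Going from `i` down to `1` and then from `N` down to `i + 1` passes every agent exactly once. -/
theorem chain_mul_chain {N i : ℕ} (hi : i ≤ N) :
    P.chain i i * P.chain N (N - i) = P.chain N N := by
  rw [mul_comm, show P.chain N N = P.chain N (N - i + i) by rw [Nat.sub_add_cancel hi]]
  simp only [chain]
  rw [Finset.prod_range_add]
  congr 1
  refine Finset.prod_congr rfl fun r hr => ?_
  rw [show N - (N - i + r) = i - r by omega]

theorem gainRatio_eq : P.gainRatio = P.chain P.N P.N := by
  rw [gainRatio, chain_eq]
  congr 1
  refine Finset.prod_nbij' (fun r => P.N - r) (fun r => P.N - r) ?_ ?_ ?_ ?_ ?_ <;>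
    intro r hr <;> simp only [Finset.mem_Icc, Finset.mem_range] at hr ⊢
  · omega
  · omega
  · omega
  · omega
  · rw [show P.N - (P.N - r) = r by omega]

/-- The terms are regrouped by whether the chain has passed agent `1`. Those that have, together
with the term `m = i`, share the factor `P.chain i i`. This is the form in which the recursion
unwinds. -/
theorem M_eq {i : ℕ} : P.M i = ∑ m ∈ Finset.range i, P.chain i m
      + P.chain i i * (1 + ∑ m ∈ Finset.Ico 1 (P.N - i), P.chain P.N m) := by
  have h1 : ∑ m ∈ Finset.range i, P.chain i m + P.chain i i
      = 1 + ∑ m ∈ Finset.Icc 1 i, P.chain i m := by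
    rw [← Finset.sum_range_succ, Finset.sum_range_succ', chain_zero, add_comm]
    congr 1
    rw [← Finset.Ico_add_one_right_eq_Icc, Finset.sum_Ico_eq_sum_range]
    exact Finset.sum_congr rfl fun m _ => by rw [add_comm]
  have h2 : ∑ m ∈ Finset.Icc (i + 1) (P.N - 1), ((∏ r ∈ Finset.range i, P.k (i - r)) *
      ∏ s ∈ Finset.range (m - i), P.k (P.N - s)) / P.l ^ m
      = P.chain i i * ∑ m ∈ Finset.Ico 1 (P.N - i), P.chain P.N m := by
    rw [Finset.mul_sum]
    refine Finset.sum_nbij' (fun m => m - i) (fun m => m + i) ?_ ?_ ?_ ?_ ?_ <;>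
      intro m hm <;> simp only [Finset.mem_Icc, Finset.mem_Ico] at hm ⊢
    · omega
    · omega
    · omega
    · omega
    · rw [chain_eq, chain_eq, div_mul_div_comm, ← pow_add, show i + (m - i) = m by omega]
  rw [M, h2]
  simp only [← chain_eq]
  linarith

namespace Admissible

variable (hP : P.Admissible)
include hP

theorem ratio_nonneg {i : ℕ} (hi : i ∈ Icc 1 P.N) : 0 ≤ P.k i / P.l :=
  div_nonneg (hP.k_mem i hi).1.le hP.l_pos.le

theorem ratio_lt_one {i : ℕ} (hi : i ∈ Icc 1 P.N) : P.k i / P.l < 1 :=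
  (div_lt_one hP.l_pos).2 (hP.k_mem i hi).2

theorem chain_nonneg {i m : ℕ} (hi : i ≤ P.N) (hm : m ≤ i) : 0 ≤ P.chain i m :=
  Finset.prod_nonneg fun r hr => hP.ratio_nonneg (by
    have := Finset.mem_range.1 hr
    constructor <;> omega)

theorem chain_le_one {i m : ℕ} (hi : i ≤ P.N) (hm : m ≤ i) : P.chain i m ≤ 1 := by
  refine Finset.prod_le_one (fun r hr => hP.ratio_nonneg ?_) fun r hr => (hP.ratio_lt_one ?_).le <;>
  · have := Finset.mem_range.1 hr
    constructor <;> omega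

theorem gainRatio_lt_one : P.gainRatio < 1 := by
  have hN := hP.two_le_N
  obtain ⟨n, hn⟩ : ∃ n, P.N = n + 1 := ⟨P.N - 1, by omega⟩
  have h1 : (1 : ℕ) ∈ Icc 1 P.N := ⟨le_rfl, by omega⟩
  rw [gainRatio_eq, show P.chain P.N P.N = P.chain P.N (n + 1) by rw [← hn], chain_succ,
    show P.N - n = 1 by omega]
  calc _ ≤ 1 * (P.k 1 / P.l) := mul_le_mul_of_nonneg_right
        (hP.chain_le_one le_rfl (by omega)) (hP.ratio_nonneg h1)
    _ < 1 := by rw [one_mul]; exact hP.ratio_lt_one h1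

theorem M_nonneg {i : ℕ} (hi : i ∈ Icc 1 P.N) : 0 ≤ P.M i := by
  rw [M_eq]
  refine add_nonneg (Finset.sum_nonneg fun m hm => hP.chain_nonneg hi.2 ?_)
    (mul_nonneg (hP.chain_nonneg hi.2 le_rfl)
      (add_nonneg zero_le_one (Finset.sum_nonneg fun m hm => hP.chain_nonneg le_rfl ?_)))
  · exact (Finset.mem_range.1 hm).le
  · have := Finset.mem_Ico.1 hm
    omega

theorem C_nonneg {i : ℕ} (hi : i ∈ Icc 1 P.N) : 0 ≤ P.C i :=
  div_nonneg (hP.M_nonneg hi) (by linarith [hP.gainRatio_lt_one])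

theorem one_le_Ctilde {i : ℕ} (hi : i ∈ Icc 1 P.N) : 1 ≤ P.Ctilde i := by
  have := mul_nonneg (hP.ratio_nonneg hi) (hP.C_nonneg (prev_mem hi))
  unfold Ctilde
  linarith

/-- The cyclic small-gain estimate. -/
theorem le_mul_C {A : ℝ} (hA : 0 ≤ A) {Y : ℕ → ℝ}
    (hY : ∀ i ∈ Icc 1 P.N, Y i ≤ A + P.k i / P.l * Y (prev P.N i)) {i : ℕ}
    (hi : i ∈ Icc 1 P.N) : Y i ≤ A * P.C i := by
  -- The recursion is unwound from `j` through agent `1` to `N`; `hdown` then unwinds from `N`, and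
  -- stopping at `i` closes the loop with `Y i` multiplied by `P.gainRatio < 1`.
  have hup : ∀ j, 1 ≤ j → j ≤ P.N →
      Y j ≤ A * ∑ m ∈ Finset.range j, P.chain j m + P.chain j j * Y P.N := by
    intro j hj
    induction j, hj using Nat.le_induction with
    | base =>
      intro h
      have := hY 1 ⟨le_rfl, h⟩
      simpa [chain, prev] using this
    | succ j hj ih =>
      intro h
      have h1 := hY (j + 1) ⟨by omega, h⟩
      rw [prev_succ hj] at h1
      have h2 := mul_le_mul_of_nonneg_left (ih (by omega))
        (hP.ratio_nonneg (i := j + 1) ⟨by omega, h⟩)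
      rw [Finset.sum_range_succ', chain_succ', chain_zero]
      simp only [chain_succ', ← Finset.mul_sum]
      linarith
  have hdown : ∀ j, j < P.N →
      Y P.N ≤ A * ∑ m ∈ Finset.range j, P.chain P.N m + P.chain P.N j * Y (P.N - j) := by
    intro j
    induction j with
    | zero => simp
    | succ j ih =>
      intro h
      have h1 := hY (P.N - j) ⟨by omega, by omega⟩
      rw [show P.N - j = (P.N - (j + 1)) + 1 by omega, prev_succ (by omega),
        show (P.N - (j + 1)) + 1 = P.N - j by omega] at h1
      have h2 := mul_le_mul_of_nonneg_left h1
        (hP.chain_nonneg (i := P.N) (m := j) le_rfl (by omega))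
      rw [Finset.sum_range_succ, chain_succ]
      linarith [ih (by omega)]
  have h1 := hup i hi.1 hi.2
  have h2 := hdown (P.N - i) (by have := hi.1; have := hi.2; omega)
  rw [show P.N - (P.N - i) = i by have := hi.2; omega] at h2
  have hc := hP.chain_nonneg hi.2 (le_refl i)
  have h3 := mul_le_mul_of_nonneg_left h2 hc
  have h4 : P.chain i i * (P.chain P.N (P.N - i) * Y i) = P.gainRatio * Y i := by
    rw [gainRatio_eq, ← chain_mul_chain hi.2]; ring
  -- Only an inequality: for `i = N` the left sum is empty, while `P.M N` still contains the term
  -- `P.chain N N`.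
  have h5 : ∑ m ∈ Finset.range (P.N - i), P.chain P.N m
      ≤ 1 + ∑ m ∈ Finset.Ico 1 (P.N - i), P.chain P.N m := by
    rcases Nat.eq_zero_or_pos (P.N - i) with h | h
    · simp [h]
    · rw [Finset.range_eq_Ico, Finset.sum_eq_sum_Ico_succ_bot h, chain_zero]
  have h6 := mul_le_mul_of_nonneg_left (mul_le_mul_of_nonneg_left h5 hc) hA
  have h7 : 0 < 1 - P.gainRatio := by linarith [hP.gainRatio_lt_one]
  rw [C, mul_div_assoc', le_div_iff₀ h7, M_eq]
  linarith

end Admissible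

end Params

/-! ### Max-norms over space, time and agents -/

theorem supNorm_nonneg {Y : Type*} (S : Set Y) (h : Y → ℝ) : 0 ≤ supNorm S h :=
  Real.sSup_nonneg (by rintro _ ⟨y, -, rfl⟩; exact abs_nonneg _)

theorem abs_le_supNorm {Y : Type*} [TopologicalSpace Y] {S : Set Y} {h : Y → ℝ}
    (hS : IsCompact S) (hh : ContinuousOn h S) {y : Y} (hy : y ∈ S) : |h y| ≤ supNorm S h :=
  le_csSup (hS.image_of_continuousOn hh.abs).bddAbove ⟨y, hy, rfl⟩

theorem supNorm_le {Y : Type*} {S : Set Y} {h : Y → ℝ} {c : ℝ} (hc : 0 ≤ c)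
    (hh : ∀ y ∈ S, |h y| ≤ c) : supNorm S h ≤ c :=
  Real.sSup_le (by rintro _ ⟨y, hy, rfl⟩; exact hh y hy) hc

theorem normC_nonneg (h : ℝ → ℝ) : 0 ≤ normC h := supNorm_nonneg _ _

theorem normT_nonneg (t : ℝ) (h : ℝ → ℝ) : 0 ≤ normT t h := supNorm_nonneg _ _

theorem normQ_nonneg (t : ℝ) (h : ℝ → ℝ → ℝ) : 0 ≤ normQ t h := supNorm_nonneg _ _

theorem abs_le_normC {h : ℝ → ℝ} (hh : ContinuousOn h (Icc 0 1)) {x : ℝ}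
    (hx : x ∈ Icc (0 : ℝ) 1) : |h x| ≤ normC h :=
  abs_le_supNorm isCompact_Icc hh hx

theorem abs_le_normT {h : ℝ → ℝ} (hh : ContinuousOn h (Ici 0)) {s t : ℝ} (hs : s ∈ Icc 0 t) :
    |h s| ≤ normT t h :=
  abs_le_supNorm isCompact_Icc (hh.mono Icc_subset_Ici_self) hs

theorem abs_le_normQ {h : ℝ → ℝ → ℝ}
    (hh : ContinuousOn (fun p : ℝ × ℝ => h p.1 p.2) (Icc (0 : ℝ) 1 ×ˢ Ici (0 : ℝ))) {x s t : ℝ}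
    (hx : x ∈ Icc (0 : ℝ) 1) (hs : s ∈ Icc 0 t) : |h x s| ≤ normQ t h :=
  abs_le_supNorm (y := (x, s)) (isCompact_Icc.prod isCompact_Icc)
    (hh.mono (prod_mono_right Icc_subset_Ici_self)) ⟨hx, hs⟩

theorem le_agentMax {N i : ℕ} (a : ℕ → ℝ) (hi : i ∈ Icc 1 N) : a i ≤ agentMax N a :=
  le_csSup ((finite_Icc 1 N).image a).bddAbove ⟨i, hi, rfl⟩

theorem agentMax_nonneg {N : ℕ} {a : ℕ → ℝ} (ha : ∀ i, 0 ≤ a i) : 0 ≤ agentMax N a :=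
  Real.sSup_nonneg (by rintro _ ⟨i, -, rfl⟩; exact ha i)

theorem agentMax_le {N : ℕ} {a : ℕ → ℝ} {c : ℝ} (hc : 0 ≤ c) (h : ∀ i ∈ Icc 1 N, a i ≤ c) :
    agentMax N a ≤ c :=
  Real.sSup_le (by rintro _ ⟨i, hi, rfl⟩; exact h i hi) hc

/-- Initial values are prescribed only on the open interval. Continuity extends the agreement to the
end points. -/
theorem normC_congr {g h : ℝ → ℝ} (hg : ContinuousOn g (Icc 0 1)) (hh : ContinuousOn h (Icc 0 1))
    (heq : ∀ x ∈ Ioo (0 : ℝ) 1, g x = h x) : normC g = normC h := by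
  have : EqOn g h (Icc 0 1) := by
    refine Measure.eqOn_Icc_of_ae_eq volume zero_ne_one ?_ hg hh
    rw [← Measure.restrict_congr_set Ioo_ae_eq_Icc]
    exact (ae_restrict_mem measurableSet_Ioo).mono heq
  unfold normC supNorm
  congr 1
  exact image_congr fun x hx => by rw [this hx]

theorem agentMax_congr {N : ℕ} {a b : ℕ → ℝ} (h : ∀ i ∈ Icc 1 N, a i = b i) :
    agentMax N a = agentMax N b := by
  unfold agentMax
  rw [image_congr h]

theorem IsSolution.size_zero {P : Params} {w : Inputs} {X₀ : Profile} {X : ℝ → Profile}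
    (hX : IsSolution P w X₀ X) (h₀ : X₀.IsContinuous P.N) : (X 0).size P.N = X₀.size P.N := by
  unfold Profile.size
  rw [agentMax_congr fun i hi => normC_congr ((hX.u_pde i hi).continuousOn_slice le_rfl)
      (h₀.u_cont i hi) (hX.u_init i hi),
    normC_congr (hX.uref_pde.continuousOn_slice le_rfl) h₀.uref_cont hX.uref_init,
    agentMax_congr fun i hi => normC_congr ((hX.v_pde i hi).continuousOn_slice le_rfl)
      (h₀.v_cont i hi) (hX.v_init i hi),
    agentMax_congr fun i hi => normC_congr ((hX.qhat_pde i hi).continuousOn_slice le_rfl)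
      (h₀.qhat_cont i hi) (hX.qhat_init i hi)]

/-! ### The explicit estimate for the closed loop -/

set_option maxHeartbeats 1000000 in
/-- The explicit decay estimate for the closed loop. -/
theorem IsSolution.norm_le {P : Params} (hP : P.Admissible) {σ : ℝ} (hσ : σ ∈ Ioo 0 P.lam)
    {w : Inputs} {X₀ : Profile} {X : ℝ → Profile} (hw : w.Regular P.N)
    (h₀ : X₀.IsContinuous P.N) (hX : IsSolution P w X₀ X) {i : ℕ} (hi : i ∈ Icc 1 P.N) {t : ℝ}
    (ht : 0 < t) :
    normC ((X t).u i) + normC (X t).uref + normC ((X t).v i) + normC ((X t).qhat i)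
      ≤ (1 + 2 * P.Ctilde i) * Real.exp (-σ * t)
          * (2 * agentMax P.N (fun j => normC (X₀.u j)) + normC X₀.uref)
        + (4 + 2 * P.Ctilde i) * Real.exp (-σ * t)
          * (agentMax P.N (fun j => normC (X₀.v j)) + agentMax P.N (fun j => normC (X₀.qhat j)))
        + 3 * normT t w.r + 2 * normT t (w.q i) + (1 + 2 * P.Ctilde i) * P.D σ w t := by
  have hl := hP.l_pos
  have hlσ : 0 < P.lam - σ := by linarith [hσ.2]
  set a := agentMax P.N (fun j => normC (X₀.u j)) with ha
  set b := normC X₀.uref with hb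
  set c := agentMax P.N (fun j => normC (X₀.v j)) with hc
  set h := agentMax P.N (fun j => normC (X₀.qhat j)) with hh
  set F := agentMax P.N (fun j => normQ t (w.f j)) / (P.lam - σ) with hF
  set δ₀ := agentMax P.N (fun j => normT t (w.d0 j)) with hδ₀
  set δ₁ := agentMax P.N (fun j => normT t (w.d1 j)) / P.l with hδ₁
  set ρ := normT t w.r with hρ
  set θ := normT t (w.q i) with hθ
  have ha0 : 0 ≤ a := agentMax_nonneg fun _ => normC_nonneg _
  have hb0 : 0 ≤ b := normC_nonneg _
  have hc0 : 0 ≤ c := agentMax_nonneg fun _ => normC_nonneg _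
  have hh0 : 0 ≤ h := agentMax_nonneg fun _ => normC_nonneg _
  have hF0 : 0 ≤ F := div_nonneg (agentMax_nonneg fun _ => normQ_nonneg _ _) hlσ.le
  have hδ₀0 : 0 ≤ δ₀ := agentMax_nonneg fun _ => normT_nonneg _ _
  have hδ₁0 : 0 ≤ δ₁ := div_nonneg (agentMax_nonneg fun _ => normT_nonneg _ _) hl.le
  have hρ0 : 0 ≤ ρ := normT_nonneg _ _
  have hθ0 : 0 ≤ θ := normT_nonneg _ _
  have hD : P.D σ w t = 2 * F + δ₀ + δ₁ := by
    simp only [Params.D, hF, hδ₀, hδ₁]; ring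
  clear_value a b c h F δ₀ δ₁ ρ θ
  set E : ℝ → ℝ := fun s => Real.exp (-σ * s) with hE
  -- For fixed final time `t`, the decaying barrier `R * z * E s` stays above `z` on `[0,t]` and
  -- equals `z` at `s = t`. A single barrier thus handles initial data and persistent inputs without
  -- splitting the solution.
  set R := Real.exp (σ * t) with hR
  have hE0 : ∀ s, 0 < E s := fun s => Real.exp_pos _
  have hR0 : 0 < R := Real.exp_pos _
  have hRE : ∀ s ∈ Ioc 0 t, 1 ≤ R * E s := fun s hs => by
    rw [hR, hE, ← Real.exp_add]
    refine Real.one_le_exp ?_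
    nlinarith [hs.2, hσ.1]
  have hREt : R * E t = 1 := by
    rw [hR, hE, ← Real.exp_add]; simp
  -- a bound by an input is also a weighted bound
  have hwt : ∀ s ∈ Ioc 0 t, ∀ y z : ℝ, 0 ≤ z → y ≤ z → y ≤ R * z * E s := fun s hs y z hz hy => by
    nlinarith [hRE s hs, mul_le_mul_of_nonneg_left (hRE s hs) hz]
  have hu0 : ∀ j ∈ Icc 1 P.N, ∀ x ∈ Ioo (0 : ℝ) 1, |(X 0).u j x| ≤ a := fun j hj x hx => by
    rw [hX.u_init j hj x hx, ha]
    exact (abs_le_normC (h₀.u_cont j hj) (Ioo_subset_Icc_self hx)).trans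
      (le_agentMax (fun j => normC (X₀.u j)) hj)
  have hv0 : ∀ j ∈ Icc 1 P.N, ∀ x ∈ Ioo (0 : ℝ) 1, |(X 0).v j x| ≤ c := fun j hj x hx => by
    rw [hX.v_init j hj x hx, hc]
    exact (abs_le_normC (h₀.v_cont j hj) (Ioo_subset_Icc_self hx)).trans
      (le_agentMax (fun j => normC (X₀.v j)) hj)
  have hq0 : ∀ j ∈ Icc 1 P.N, ∀ x ∈ Ioo (0 : ℝ) 1, |(X 0).qhat j x| ≤ h := fun j hj x hx => by
    rw [hX.qhat_init j hj x hx, hh]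
    exact (abs_le_normC (h₀.qhat_cont j hj) (Ioo_subset_Icc_self hx)).trans
      (le_agentMax (fun j => normC (X₀.qhat j)) hj)
  have hr0 : ∀ x ∈ Ioo (0 : ℝ) 1, |(X 0).uref x| ≤ b := fun x hx => by
    rw [hX.uref_init x hx, hb]
    exact abs_le_normC h₀.uref_cont (Ioo_subset_Icc_self hx)
  have hfb : ∀ j ∈ Icc 1 P.N, ∀ s ∈ Ioc 0 t, ∀ x ∈ Ioo (0 : ℝ) 1, ∀ G, R * F ≤ G →
      |w.f j x s| ≤ (P.lam - σ) * (G * E s) := fun j hj s hs x hx G hG => by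
    have h1 : |w.f j x s| ≤ (P.lam - σ) * F := by
      rw [hF, mul_div_cancel₀ _ hlσ.ne']
      exact (abs_le_normQ (hw.f_cont j hj) (Ioo_subset_Icc_self hx) ⟨hs.1.le, hs.2⟩).trans
        (le_agentMax (fun j => normQ t (w.f j)) hj)
    refine h1.trans (mul_le_mul_of_nonneg_left ?_ hlσ.le)
    exact (hwt s hs F F hF0 le_rfl).trans (mul_le_mul_of_nonneg_right hG (hE0 s).le)
  have hd0b : ∀ j ∈ Icc 1 P.N, ∀ s ∈ Ioc 0 t, |w.d0 j s| ≤ R * δ₀ * E s := fun j hj s hs =>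
    hwt s hs _ _ hδ₀0 (by
      rw [hδ₀]
      exact (abs_le_normT (hw.d0_contDiff j hj).continuousOn ⟨hs.1.le, hs.2⟩).trans
        (le_agentMax (fun j => normT t (w.d0 j)) hj))
  have hd1b : ∀ j ∈ Icc 1 P.N, ∀ s ∈ Ioc 0 t, |w.d1 j s| ≤ P.l * (R * δ₁ * E s) :=
    fun j hj s hs => by
      have h1 : |w.d1 j s| ≤ P.l * δ₁ := by
        rw [hδ₁, mul_div_cancel₀ _ hl.ne']
        exact (abs_le_normT (hw.d1_contDiff j hj).continuousOn ⟨hs.1.le, hs.2⟩).trans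
          (le_agentMax (fun j => normT t (w.d1 j)) hj)
      exact h1.trans (mul_le_mul_of_nonneg_left (hwt s hs _ _ hδ₁0 le_rfl) hl.le)
  have hrb : ∀ s ∈ Ioc 0 t, |w.r s| ≤ R * ρ * E s := fun s hs =>
    hwt s hs _ _ hρ0 (hρ ▸ abs_le_normT hw.r_contDiff.continuousOn ⟨hs.1.le, hs.2⟩)
  have hqb : ∀ s ∈ Ioc 0 t, |w.q i s| ≤ R * θ * E s := fun s hs =>
    hwt s hs _ _ hθ0 (hθ ▸ abs_le_normT (hw.q_contDiff i hi).continuousOn ⟨hs.1.le, hs.2⟩)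
  -- the difference `u - v`
  have hzpde : ∀ j ∈ Icc 1 P.N, SolvesPDE P.α P.lam (fun x s => w.f j x s - 0)
      (fun x s => (X s).u j x - (X s).v j x) := fun j hj => (hX.u_pde j hj).sub (hX.v_pde j hj)
  have hzleft : ∀ j ∈ Icc 1 P.N, ∀ s, 0 < s → (X s).u j 0 - (X s).v j 0 = w.q j s :=
    fun j hj s hs => by rw [hX.u_left j hj s hs, hX.v_left j hj s hs]; ring
  have hzd : ∀ j ∈ Icc 1 P.N, ∀ s, 0 < s → ∀ x ∈ Icc (0 : ℝ) 1,
      xDeriv (fun x => (X s).u j x - (X s).v j x) x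
        = xDeriv ((X s).u j) x - xDeriv ((X s).v j) x := fun j hj s hs x hx =>
    xDeriv_sub ((hX.u_pde j hj).differentiableOn_slice hs.le)
      ((hX.v_pde j hj).differentiableOn_slice hs.le) hx
  have hzright : ∀ j ∈ Icc 1 P.N, ∀ s, 0 < s →
      xDeriv (fun x => (X s).u j x - (X s).v j x) 1 = -P.l * ((X s).u j 1 - (X s).v j 1) :=
    fun j hj s hs => by
      rw [hzd j hj s hs 1 (by simp), hX.u_right j hj s hs, hX.v_right j hj s hs]; ring
  have hz := (hzpde i hi).abs_le_barrier (σ := σ) (T := t) (G := a + c + R * F + R * θ)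
    (g := fun _ => 0) (l := P.l) hP.α_pos hP.lam_pos.le hl.le
    (fun s hs x hx => by
      rw [sub_zero]
      exact hfb i hi s hs x hx _ (by nlinarith))
    (fun x hx => by
      have h1 := hu0 i hi x hx
      have h2 := hv0 i hi x hx
      exact (abs_sub _ _).trans (by nlinarith))
    (fun s hs => Or.inl (by
      rw [hzleft i hi s hs.1]
      exact (hqb s hs).trans (mul_le_mul_of_nonneg_right (by nlinarith) (hE0 s).le)))
    (fun s hs => by rw [hzright i hi s hs.1, add_zero])
    (fun s hs => by
      rw [abs_zero]
      have := hE0 s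
      positivity)
  -- the observation error
  have he : ∀ j ∈ Icc 1 P.N, ∀ s ∈ Icc 0 t, ∀ x ∈ Icc (0 : ℝ) 1,
      |(X s).qhat j x - ((X s).u j x - (X s).v j x)| ≤ (a + c + h + R * F) * E s := by
    intro j hj
    have hed : ∀ s, 0 < s → ∀ x ∈ Icc (0 : ℝ) 1,
        xDeriv (fun x => (X s).qhat j x - ((X s).u j x - (X s).v j x)) x
          = xDeriv ((X s).qhat j) x - xDeriv (fun x => (X s).u j x - (X s).v j x) x :=
      fun s hs x hx => xDeriv_sub ((hX.qhat_pde j hj).differentiableOn_slice hs.le)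
        ((hzpde j hj).differentiableOn_slice hs.le) hx
    -- The flux of `qhat` at `0` is that of `u - v`, so the error satisfies a homogeneous Neumann
    -- condition there and `q` does not enter the bound.
    refine ((hX.qhat_pde j hj).sub (hzpde j hj)).abs_le_barrier (g := fun _ => 0) (l := P.l)
      hP.α_pos hP.lam_pos.le hl.le (fun s hs x hx => ?_) (fun x hx => ?_) (fun s hs => Or.inr ?_)
      (fun s hs => ?_) (fun s hs => ?_)
    · rw [sub_zero, zero_sub, abs_neg]
      exact hfb j hj s hs x hx _ (by nlinarith)
    · have h1 := hu0 j hj x hx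
      have h2 := hv0 j hj x hx
      have h3 := hq0 j hj x hx
      have h4 := abs_sub ((X 0).qhat j x) ((X 0).u j x - (X 0).v j x)
      have h5 := abs_sub ((X 0).u j x) ((X 0).v j x)
      nlinarith
    · rw [hed s hs.1 0 (by simp), hX.qhat_left j hj s hs.1, hzd j hj s hs.1 0 (by simp), sub_self]
    · rw [hed s hs.1 1 (by simp), hX.qhat_right j hj s hs.1, hzright j hj s hs.1]; ring
    · rw [abs_zero]
      have := hE0 s
      positivity
  -- The feedback of `qhat` cancels `q` up to the observation error, because `u - v` equals `q` at
  -- `0`.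
  have hcontrol0 : ∀ j ∈ Icc 1 P.N, ∀ s, 0 < s → w.q j s + control0 w X j s
      = w.r s - ((X s).qhat j 0 - ((X s).u j 0 - (X s).v j 0)) + w.d0 j s := fun j hj s hs => by
    rw [hzleft j hj s hs, control0]; ring
  -- the tracking error
  set A := 2 * a + b + c + h + R * (2 * F + δ₀ + δ₁) with hA
  have hA0 : 0 ≤ A := by positivity
  clear_value A
  have hypde : ∀ j ∈ Icc 1 P.N, SolvesPDE P.α P.lam (fun x s => w.f j x s - 0)
      (fun x s => (X s).u j x - (X s).uref x) := fun j hj => (hX.u_pde j hj).sub hX.uref_pde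
  -- Continuity of the boundary traces on the compact interval makes these suprema finite. Without
  -- it the cyclic estimate could not absorb `Y` into itself, and `sSup` could take its default
  -- value `0`.
  set Y : ℕ → ℝ := fun j => sSup ((fun s => Real.exp (σ * s) * |(X s).u j 1 - (X s).uref 1|) ''
    Icc 0 t) with hYdef
  have hYle : ∀ j ∈ Icc 1 P.N, ∀ s ∈ Icc 0 t, |(X s).u j 1 - (X s).uref 1| ≤ Y j * E s := by
    intro j hj s hs
    have hcont : ContinuousOn (fun s => Real.exp (σ * s) * |(X s).u j 1 - (X s).uref 1|)
        (Icc 0 t) :=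
      (by fun_prop : Continuous fun s : ℝ => Real.exp (σ * s)).continuousOn.mul
        (((hypde j hj).continuousOn_right.mono Icc_subset_Ici_self).abs)
    have h1 : Real.exp (σ * s) * |(X s).u j 1 - (X s).uref 1| ≤ Y j :=
      le_csSup (isCompact_Icc.image_of_continuousOn hcont).bddAbove ⟨s, hs, rfl⟩
    have h2 : Real.exp (σ * s) * E s = 1 := by rw [hE, ← Real.exp_add]; simp
    calc |(X s).u j 1 - (X s).uref 1|
        = Real.exp (σ * s) * |(X s).u j 1 - (X s).uref 1| * E s := by
          rw [mul_right_comm, h2, one_mul]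
      _ ≤ Y j * E s := mul_le_mul_of_nonneg_right h1 (hE0 s).le
  have hY0 : ∀ j, 0 ≤ Y j := fun j => Real.sSup_nonneg (by
    rintro _ ⟨s, -, rfl⟩
    positivity)
  have hB0 : ∀ j ∈ Icc 1 P.N, 0 ≤ P.k j / P.l * Y (prev P.N j) := fun j hj =>
    mul_nonneg (hP.ratio_nonneg hj) (hY0 _)
  have hcontrol1 : ∀ j ∈ Icc 1 P.N, ∀ s ∈ Ioc 0 t, ∀ G,
      P.k j / P.l * Y (prev P.N j) + R * δ₁ ≤ G → |control1 P w X j s| ≤ P.l * (G * E s) := by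
    intro j hj s hs G hG
    have hk := (hP.k_mem j hj).1
    have h1 := hYle (prev P.N j) (prev_mem hj) s ⟨hs.1.le, hs.2⟩
    have h2 := mul_le_mul_of_nonneg_left h1 hk.le
    have h3 := hd1b j hj s hs
    have h4 := mul_le_mul_of_nonneg_left (mul_le_mul_of_nonneg_right hG (hE0 s).le) hl.le
    have h5 : P.l * ((P.k j / P.l * Y (prev P.N j) + R * δ₁) * E s)
        = P.k j * (Y (prev P.N j) * E s) + P.l * (R * δ₁ * E s) := by
      field_simp
    unfold control1
    refine (abs_add_le _ _).trans ?_
    rw [abs_mul, abs_of_pos hk]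
    linarith
  -- `A` is the sum of what the barrier must dominate: `a + c + h + R * F + R * δ₀` for the boundary
  -- value `d0 - e`, `a + b` for the initial data, `R * F` for the source and `R * δ₁` for the Robin
  -- input. Its second `F` comes from the observation error.
  have hy : ∀ j ∈ Icc 1 P.N, ∀ s ∈ Icc 0 t, ∀ x ∈ Icc (0 : ℝ) 1,
      |(X s).u j x - (X s).uref x| ≤ (A + P.k j / P.l * Y (prev P.N j)) * E s := by
    intro j hj
    have hB := hB0 j hj
    refine (hypde j hj).abs_le_barrier (g := control1 P w X j) (l := P.l)
      hP.α_pos hP.lam_pos.le hl.le (fun s hs x hx => ?_) (fun x hx => ?_) (fun s hs => Or.inl ?_)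
      (fun s hs => ?_) (fun s hs => hcontrol1 j hj s hs _ ?_)
    · rw [sub_zero]
      refine hfb j hj s hs x hx _ ?_
      have : 0 ≤ R * (F + δ₀ + δ₁) := by positivity
      rw [hA]; linarith
    · have h1 := hu0 j hj x hx
      have h2 := hr0 x hx
      have : 0 ≤ R * (2 * F + δ₀ + δ₁) := by positivity
      refine (abs_sub _ _).trans ?_
      rw [hA]; linarith
    · rw [hX.u_left j hj s hs.1, hX.uref_left s hs.1, hcontrol0 j hj s hs.1,
        show ∀ r e d : ℝ, r - e + d - r = d - e by intros; ring]
      have h1 := he j hj s ⟨hs.1.le, hs.2⟩ 0 (by simp)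
      have h2 := hd0b j hj s hs
      have h3 : 0 ≤ (a + b + R * (F + δ₁) + P.k j / P.l * Y (prev P.N j)) * E s := by
        have := hE0 s
        positivity
      refine (abs_sub _ _).trans ?_
      rw [hA]; linarith
    · rw [xDeriv_sub ((hX.u_pde j hj).differentiableOn_slice hs.1.le)
        (hX.uref_pde.differentiableOn_slice hs.1.le) (by simp), hX.u_right j hj s hs.1,
        hX.uref_right s hs.1]
      ring
    · have : 0 ≤ R * (2 * F + δ₀) := by positivity
      rw [hA]; linarith
  have hYrec : ∀ j ∈ Icc 1 P.N, Y j ≤ A + P.k j / P.l * Y (prev P.N j) := by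
    intro j hj
    refine Real.sSup_le ?_ (add_nonneg hA0 (hB0 j hj))
    rintro _ ⟨s, hs, rfl⟩
    have h1 := hy j hj s hs 1 (by simp)
    have h2 : Real.exp (σ * s) * E s = 1 := by rw [hE, ← Real.exp_add]; simp
    calc Real.exp (σ * s) * |(X s).u j 1 - (X s).uref 1|
        ≤ Real.exp (σ * s) * ((A + P.k j / P.l * Y (prev P.N j)) * E s) :=
          mul_le_mul_of_nonneg_left h1 (Real.exp_pos _).le
      _ = A + P.k j / P.l * Y (prev P.N j) := by rw [mul_left_comm, h2, mul_one]
  set B := P.k i / P.l * Y (prev P.N i) with hBdef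
  have hB : 0 ≤ B := hB0 i hi
  -- `P.Ctilde i - 1` is exactly the gain `k i / l` times `P.C` of the predecessor.
  have hBle : B ≤ (P.Ctilde i - 1) * A := by
    have h1 := mul_le_mul_of_nonneg_left (hP.le_mul_C hA0 hYrec (prev_mem hi))
      (hP.ratio_nonneg hi)
    rw [Params.Ctilde, hBdef]
    linarith
  have hcontrol1i := hcontrol1 i hi
  rw [← hBdef] at hcontrol1i
  clear_value B
  -- the four components
  have hu := (hX.u_pde i hi).abs_le_barrier (σ := σ) (T := t) (G := A + B + R * ρ)
    (g := control1 P w X i) (l := P.l) hP.α_pos hP.lam_pos.le hl.le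
    (fun s hs x hx => hfb i hi s hs x hx _ (by
      have : 0 ≤ R * (F + δ₀ + δ₁ + ρ) := by positivity
      rw [hA]; linarith))
    (fun x hx => by
      have h1 := hu0 i hi x hx
      have : 0 ≤ R * (2 * F + δ₀ + δ₁ + ρ) := by positivity
      rw [hA]; linarith)
    (fun s hs => Or.inl (by
      rw [hX.u_left i hi s hs.1, hcontrol0 i hi s hs.1]
      have h1 := he i hi s ⟨hs.1.le, hs.2⟩ 0 (by simp)
      have h2 := hd0b i hi s hs
      have h3 := hrb s hs
      have h4 : 0 ≤ (a + b + R * (F + δ₁) + B) * E s := by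
        have := hE0 s
        positivity
      refine (abs_add_le _ _).trans ?_
      have h5 := abs_sub (w.r s) ((X s).qhat i 0 - ((X s).u i 0 - (X s).v i 0))
      rw [hA]; linarith))
    (fun s hs => hX.u_right i hi s hs.1)
    (fun s hs => hcontrol1i s hs _ (by
      have : 0 ≤ R * (2 * F + δ₀ + ρ) := by positivity
      rw [hA]; linarith))
  have hv := (hX.v_pde i hi).abs_le_barrier (σ := σ) (T := t) (G := A + B + c + R * ρ + R * θ)
    (g := control1 P w X i) (l := P.l) hP.α_pos hP.lam_pos.le hl.le
    (fun s hs x hx => by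
      rw [abs_zero]
      have := hE0 s
      positivity)
    (fun x hx => by
      have h1 := hv0 i hi x hx
      have : 0 ≤ R * ρ + R * θ := by positivity
      linarith)
    (fun s hs => Or.inl (by
      -- The value of `v` at `0` is the Dirichlet value of `u` minus `q`, which brings in the
      -- already bounded observation error.
      have h0 : (X s).v i 0 = w.r s - ((X s).qhat i 0 - ((X s).u i 0 - (X s).v i 0)) + w.d0 i s
          - w.q i s := by
        rw [← hcontrol0 i hi s hs.1, hX.v_left i hi s hs.1]; ring
      have h1 := he i hi s ⟨hs.1.le, hs.2⟩ 0 (by simp)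
      have h2 := hd0b i hi s hs
      have h3 := hrb s hs
      have h4 : 0 ≤ (a + b + c + R * (F + δ₁) + B) * E s := by
        have := hE0 s
        positivity
      have h5 := abs_sub (w.r s) ((X s).qhat i 0 - ((X s).u i 0 - (X s).v i 0))
      have h6 := abs_add_le (w.r s - ((X s).qhat i 0 - ((X s).u i 0 - (X s).v i 0))) (w.d0 i s)
      have h7 := hqb s hs
      rw [h0]
      refine (abs_sub _ _).trans ?_
      rw [hA]; linarith))
    (fun s hs => hX.v_right i hi s hs.1)
    (fun s hs => hcontrol1i s hs _ (by
      have : 0 ≤ R * (2 * F + δ₀ + ρ + θ) := by positivity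
      rw [hA]; linarith))
  have hr := hX.uref_pde.abs_le_barrier (σ := σ) (T := t) (G := b + R * ρ)
    (g := fun _ => 0) (l := P.l) hP.α_pos hP.lam_pos.le hl.le
    (fun s hs x hx => by
      rw [abs_zero]
      have := hE0 s
      positivity)
    (fun x hx => by
      have h1 := hr0 x hx
      have : 0 ≤ R * ρ := by positivity
      linarith)
    (fun s hs => Or.inl (by
      rw [hX.uref_left s hs.1]
      exact (hrb s hs).trans (mul_le_mul_of_nonneg_right (by linarith) (hE0 s).le)))
    (fun s hs => by rw [hX.uref_right s hs.1, add_zero])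
    (fun s hs => by
      rw [abs_zero]
      have := hE0 s
      positivity)
  have htt : t ∈ Icc 0 t := ⟨ht.le, le_rfl⟩
  have hEt := hE0 t
  have nu : normC ((X t).u i) ≤ (A + B + R * ρ) * E t :=
    supNorm_le (by positivity) (hu t htt)
  have nv : normC ((X t).v i) ≤ (A + B + c + R * ρ + R * θ) * E t :=
    supNorm_le (by positivity) (hv t htt)
  have nr : normC (X t).uref ≤ (b + R * ρ) * E t := supNorm_le (by positivity) (hr t htt)
  -- `qhat` is the observation error plus `u - v`.
  have nq : normC ((X t).qhat i) ≤ (2 * a + 2 * c + h + 2 * (R * F) + R * θ) * E t := by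
    refine supNorm_le (by positivity) fun x hx => ?_
    have h1 := he i hi t htt x hx
    have h2 : |(X t).u i x - (X t).v i x| ≤ (a + c + R * F + R * θ) * E t := hz t htt x hx
    have h3 := abs_add_le ((X t).qhat i x - ((X t).u i x - (X t).v i x))
      ((X t).u i x - (X t).v i x)
    rw [sub_add_cancel] at h3
    linarith
  have hBE := mul_le_mul_of_nonneg_right hBle hEt.le
  have hAE : A * E t = (2 * a + b + c + h) * E t + (2 * F + δ₀ + δ₁) := by
    rw [hA, add_mul, mul_right_comm, hREt, one_mul]
  have hRt : ∀ x, R * x * E t = x := fun x => by rw [mul_right_comm, hREt, one_mul]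
  have e1 : (P.Ctilde i - 1) * A * E t
      = (P.Ctilde i - 1) * ((2 * a + b + c + h) * E t + (2 * F + δ₀ + δ₁)) := by
    rw [mul_assoc, hAE]
  have e2 := hRt ρ
  have e3 := hRt θ
  have e4 := hRt F
  -- Beyond `2 * P.Ctilde i * A`, the four bounds contribute only `3 * c + h` in these data; the
  -- stated coefficient `4` on `c + h` leaves slack that these signs absorb.
  have p1 : 0 ≤ h * E t := by positivity
  have p2 : 0 ≤ c * E t := by positivity
  change _ ≤ (1 + 2 * P.Ctilde i) * E t * (2 * a + b) + (4 + 2 * P.Ctilde i) * E t * (c + h)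
    + 3 * ρ + 2 * θ + (1 + 2 * P.Ctilde i) * P.D σ w t
  rw [hD]
  rw [e1] at hBE
  linarith

/-! ### Comparison functions and input-to-state stability -/

theorem classK_mul {c : ℝ} (hc : 0 < c) : ClassK fun s => c * s :=
  ⟨(continuous_const.mul continuous_id).continuousOn,
    fun _ _ _ _ h => mul_lt_mul_of_pos_left h hc, mul_zero c⟩

theorem classKL_mul_exp {c σ : ℝ} (hc : 0 < c) (hσ : 0 < σ) :
    ClassKL fun s t => c * Real.exp (-σ * t) * s := by
  refine ⟨by fun_prop, fun t _ => classK_mul (mul_pos hc (Real.exp_pos _)), fun s hs => ⟨?_, ?_⟩⟩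
  · intro t _ t' _ h
    refine mul_lt_mul_of_pos_right (mul_lt_mul_of_pos_left (Real.exp_lt_exp.2 ?_) hc) hs
    nlinarith
  · have h1 : Tendsto (fun t : ℝ => -σ * t) atTop atBot :=
      tendsto_id.const_mul_atTop_of_neg (neg_lt_zero.2 hσ)
    have h2 := ((Real.tendsto_exp_atBot.comp h1).const_mul c).mul_const s
    simpa using h2

theorem Inputs.size_nonneg (w : Inputs) (N : ℕ) (t : ℝ) : 0 ≤ w.size N t :=
  add_nonneg (add_nonneg (add_nonneg (add_nonneg (agentMax_nonneg fun _ => normQ_nonneg _ _)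
    (agentMax_nonneg fun _ => normT_nonneg _ _)) (agentMax_nonneg fun _ => normT_nonneg _ _))
    (normT_nonneg _ _)) (agentMax_nonneg fun _ => normT_nonneg _ _)

theorem Profile.size_nonneg (X : Profile) (N : ℕ) : 0 ≤ X.size N :=
  add_nonneg (add_nonneg (add_nonneg (agentMax_nonneg fun _ => normC_nonneg _)
    (normC_nonneg _)) (agentMax_nonneg fun _ => normC_nonneg _))
    (agentMax_nonneg fun _ => normC_nonneg _)

/-- The disturbances contributing to `D` are controlled by the size of all inputs. -/
theorem Params.D_le_size {P : Params} (hP : P.Admissible) {σ : ℝ} (hσ : σ < P.lam) (w : Inputs)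
    (t : ℝ) : P.D σ w t ≤ (2 / (P.lam - σ) + 1 + 1 / P.l) * w.size P.N t := by
  have h1 : 0 ≤ agentMax P.N (fun i => normQ t (w.f i)) := agentMax_nonneg fun _ => normQ_nonneg _ _
  have h2 : 0 ≤ agentMax P.N (fun i => normT t (w.d0 i)) := agentMax_nonneg fun _ => normT_nonneg _ _
  have h3 : 0 ≤ agentMax P.N (fun i => normT t (w.d1 i)) := agentMax_nonneg fun _ => normT_nonneg _ _
  have h4 : 0 ≤ normT t w.r := normT_nonneg _ _
  have h5 : 0 ≤ agentMax P.N (fun i => normT t (w.q i)) := agentMax_nonneg fun _ => normT_nonneg _ _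
  have hs : 0 ≤ 2 / (P.lam - σ) := div_nonneg zero_le_two (by linarith)
  have hl : 0 ≤ 1 / P.l := div_nonneg zero_le_one hP.l_pos.le
  have e1 : agentMax P.N (fun i => normQ t (w.f i)) ≤ w.size P.N t := by
    unfold Inputs.size; linarith
  have e2 : agentMax P.N (fun i => normT t (w.d0 i)) ≤ w.size P.N t := by
    unfold Inputs.size; linarith
  have e3 : agentMax P.N (fun i => normT t (w.d1 i)) ≤ w.size P.N t := by
    unfold Inputs.size; linarith
  unfold Params.D
  linarith [mul_le_mul_of_nonneg_left e1 hs, mul_le_mul_of_nonneg_left e3 hl]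

/-- The constants come from `2 * (1 + 2 * C) + (4 + 2 * C) = 6 + 6 * C` with `C = P.Ctilde i`, and
`3 + 2 = 5` for `r` and `q`. -/
theorem IsSolution.norm_le_size {P : Params} (hP : P.Admissible) {σ : ℝ} (hσ : σ ∈ Ioo 0 P.lam)
    {w : Inputs} {X₀ : Profile} {X : ℝ → Profile} (hw : w.Regular P.N)
    (h₀ : X₀.IsContinuous P.N) (hX : IsSolution P w X₀ X) {i : ℕ} (hi : i ∈ Icc 1 P.N) {t : ℝ}
    (ht : 0 < t) :
    normC ((X t).u i) + normC (X t).uref + normC ((X t).v i) + normC ((X t).qhat i)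
      ≤ (6 + 6 * P.Ctilde i) * (Real.exp (-σ * t) * X₀.size P.N)
        + (5 + (1 + 2 * P.Ctilde i) * (2 / (P.lam - σ) + 1 + 1 / P.l)) * w.size P.N t := by
  have hC := hP.one_le_Ctilde hi
  have hE := (Real.exp_pos (-σ * t)).le
  have h1 : 0 ≤ agentMax P.N (fun j => normC (X₀.u j)) := agentMax_nonneg fun _ => normC_nonneg _
  have h2 : 0 ≤ normC X₀.uref := normC_nonneg _
  have h3 : 0 ≤ agentMax P.N (fun j => normC (X₀.v j)) := agentMax_nonneg fun _ => normC_nonneg _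
  have h4 : 0 ≤ agentMax P.N (fun j => normC (X₀.qhat j)) := agentMax_nonneg fun _ => normC_nonneg _
  have e1 : 2 * agentMax P.N (fun j => normC (X₀.u j)) + normC X₀.uref ≤ 2 * X₀.size P.N := by
    unfold Profile.size; linarith
  have e2 : agentMax P.N (fun j => normC (X₀.v j)) + agentMax P.N (fun j => normC (X₀.qhat j))
      ≤ X₀.size P.N := by
    unfold Profile.size; linarith
  have k1 : 0 ≤ agentMax P.N (fun i => normQ t (w.f i)) := agentMax_nonneg fun _ => normQ_nonneg _ _
  have k2 : 0 ≤ agentMax P.N (fun i => normT t (w.d0 i)) := agentMax_nonneg fun _ => normT_nonneg _ _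
  have k3 : 0 ≤ agentMax P.N (fun i => normT t (w.d1 i)) := agentMax_nonneg fun _ => normT_nonneg _ _
  have k4 : 0 ≤ normT t w.r := normT_nonneg _ _
  have k5 : 0 ≤ normT t (w.q i) := normT_nonneg _ _
  have k6 := le_agentMax (fun i => normT t (w.q i)) hi
  have e3 : 3 * normT t w.r + 2 * normT t (w.q i) ≤ 5 * w.size P.N t := by
    unfold Inputs.size
    linarith
  have f1 := mul_le_mul_of_nonneg_left e1
    (mul_nonneg (by linarith : 0 ≤ 1 + 2 * P.Ctilde i) hE)
  have f2 := mul_le_mul_of_nonneg_left e2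
    (mul_nonneg (by linarith : 0 ≤ 4 + 2 * P.Ctilde i) hE)
  have f3 := mul_le_mul_of_nonneg_left (Params.D_le_size hP hσ.2 w t)
    (by linarith : 0 ≤ 1 + 2 * P.Ctilde i)
  linarith [hX.norm_le hP hσ hw h₀ hi ht]

theorem Params.Admissible.inputToStateStable {P : Params} (hP : P.Admissible) :
    InputToStateStable P := by
  have hlam := hP.lam_pos
  have hσ : P.lam / 2 ∈ Ioo 0 P.lam := ⟨by linarith, by linarith⟩
  have hN : 1 ∈ Icc 1 P.N := ⟨le_rfl, by linarith [hP.two_le_N]⟩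
  -- A bound for all `P.Ctilde i` at once that depends on the parameters only; the summands are
  -- nonnegative.
  set κ := ∑ i ∈ Finset.Icc 1 P.N, P.Ctilde i with hκ
  have hκi : ∀ i ∈ Icc 1 P.N, P.Ctilde i ≤ κ := fun i hi =>
    Finset.single_le_sum (f := P.Ctilde) (fun j hj =>
      zero_le_one.trans (hP.one_le_Ctilde (Finset.mem_Icc.1 hj))) (Finset.mem_Icc.2 hi)
  have hκ0 : 0 < κ := zero_lt_one.trans_le ((hP.one_le_Ctilde hN).trans (hκi 1 hN))
  set d := 2 / (P.lam - P.lam / 2) + 1 + 1 / P.l with hd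
  have hd0 : 0 < d := by
    have h1 : 0 < 2 / (P.lam - P.lam / 2) := div_pos two_pos (by linarith)
    have h2 : 0 < 1 / P.l := div_pos one_pos hP.l_pos
    linarith
  -- The factor `4` arises because the maxima in the state norm may be attained by different agents,
  -- so its four summands are bounded separately.
  have hK : 0 < 4 * (6 + 6 * κ) := by positivity
  have hK' : 0 < 4 * (5 + (1 + 2 * κ) * d) := by positivity
  refine ⟨_, _, classKL_mul_exp hK hσ.1, classK_mul hK', fun w X₀ X hw h₀ hX t ht => ?_⟩
  have hS := X₀.size_nonneg P.N
  have hI := w.size_nonneg P.N t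
  rcases ht.eq_or_lt with rfl | ht
  -- The explicit estimate covers `t > 0` only. At `t = 0` the state has the size of the initial
  -- data, and the constant in `β` exceeds `1`.
  · rw [hX.size_zero h₀]
    have := mul_nonneg hK'.le hI
    simp only [mul_zero, Real.exp_zero, mul_one]
    nlinarith [mul_nonneg hκ0.le hS]
  · have hES : 0 ≤ Real.exp (-(P.lam / 2) * t) * X₀.size P.N :=
      mul_nonneg (Real.exp_pos _).le hS
    set b := (6 + 6 * κ) * (Real.exp (-(P.lam / 2) * t) * X₀.size P.N)
      + (5 + (1 + 2 * κ) * d) * w.size P.N t with hb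
    have hb0 : 0 ≤ b := by positivity
    have hle : ∀ i ∈ Icc 1 P.N, normC ((X t).u i) + normC (X t).uref + normC ((X t).v i)
        + normC ((X t).qhat i) ≤ b := fun i hi => by
      refine (hX.norm_le_size hP hσ hw h₀ hi ht).trans ?_
      have := hκi i hi
      rw [hb, hd]
      gcongr
    have n1 := fun i => normC_nonneg ((X t).u i)
    have n2 := normC_nonneg (X t).uref
    have n3 := fun i => normC_nonneg ((X t).v i)
    have n4 := fun i => normC_nonneg ((X t).qhat i)
    have m1 : agentMax P.N (fun i => normC ((X t).u i)) ≤ b := agentMax_le hb0 fun i hi => by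
      linarith [hle i hi, n3 i, n4 i]
    have m2 : normC (X t).uref ≤ b := by linarith [hle 1 hN, n1 1, n3 1, n4 1]
    have m3 : agentMax P.N (fun i => normC ((X t).v i)) ≤ b := agentMax_le hb0 fun i hi => by
      linarith [hle i hi, n1 i, n4 i]
    have m4 : agentMax P.N (fun i => normC ((X t).qhat i)) ≤ b := agentMax_le hb0 fun i hi => by
      linarith [hle i hi, n1 i, n3 i]
    unfold Profile.size at *
    linarith

end MAS

theorem theorem4 (P : MAS.Params) (hP : P.Admissible) :
    MAS.InputToStateStable P ∧
    ∀ σ ∈ Set.Ioo 0 P.lam,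
    ∀ (w : MAS.Inputs) (X₀ : MAS.Profile) (X : ℝ → MAS.Profile),
      w.Regular P.N → X₀.IsContinuous P.N → MAS.IsSolution P w X₀ X →
      ∀ i ∈ Set.Icc 1 P.N, ∀ t : ℝ, 0 < t →
        MAS.normC ((X t).u i) + MAS.normC (X t).uref
            + MAS.normC ((X t).v i) + MAS.normC ((X t).qhat i)
          ≤ (1 + 2 * P.Ctilde i) * Real.exp (-σ * t)
              * (2 * MAS.agentMax P.N (fun j => MAS.normC (X₀.u j)) + MAS.normC X₀.uref)
            + (4 + 2 * P.Ctilde i) * Real.exp (-σ * t)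
              * (MAS.agentMax P.N (fun j => MAS.normC (X₀.v j))
                  + MAS.agentMax P.N (fun j => MAS.normC (X₀.qhat j)))
            + 3 * MAS.normT t w.r + 2 * MAS.normT t (w.q i)
            + (1 + 2 * P.Ctilde i) * P.D σ w t := by
  exact ⟨hP.inputToStateStable, fun σ hσ w X₀ X hw h₀ hX i hi t ht => hX.norm_le hP hσ hw h₀ hi ht⟩
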